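/- Let $G$ be a finite simple graph with maximum degree $\Delta \neq 2$. A pebble distribution is a function $P : V(G) \to \mathbb{Z}_{\ge 0}$, of size $|P| = \sum_v P(v)$. A pebbling move removes two pebbles from a vertex having at least two pebbles and adds one pebble at a neighbor of it. A vertex $v$ is $k$-reachable under $P$ if some finite (possibly empty) sequence of pebbling moves starting from $P$ leads to a distribution with at least $k$ pebbles on $v$; it is reachable if it is $1$-reachable. $P$ is solvable if every vertex is reachable under $P$. Let $\operatorname{cov}(P)$ be the number of vertices reachable under $P$, let $\operatorname{reach}(P,v)$ be the greatest $k$ such that $v$ is $k$-reachable under $P$, and put $\operatorname{exc}(P,v) = \operatorname{reach}(P,v) - 1$ if $v$ is reachable under $P$ and $\operatorname{exc}(P,v)=0$ otherwise. Put $\operatorname{TE}(P) = \sum_{v \in V(G)} \operatorname{exc}(P,v)$, and for distributions $P, Q$ define the cooperation excess $\operatorname{CE}(P,Q) = \operatorname{TE}(P+Q) - \operatorname{TE}(P) - \operatorname{TE}(Q)$, where $P+Q$ is the pointwise sum. A unit is a distribution under which exactly one vertex has pebbles, and two distributions are disjoint if no vertex has pebbles under both. Theorem. Let $P$ be a solvable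 pebble distribution on $G$, and let $P = U_1 + \dots + U_t$ be a decomposition of $P$ into pairwise disjoint units, indexed so that $|U_1| \le |U_2| \le \dots \le |U_t|$. Then $$\sum_{i=1}^t \operatorname{CE}\Bigl(\sum_{k=1}^{i-1} U_k,\; U_i\Bigr) \;\ge\; \frac{|V(G)| - \sum_{i=1}^t \operatorname{cov}(U_i)}{\Delta - 2}.$$ -/

import Mathlib

namespace Pebbling

section

variable {V : Type*}

/-- A pebble distribution on the vertex set `V`. -/
abbrev Distribution (V : Type*) := V → ℕ

open Classical in
/-- `Move G P Q`: a single pebbling move turns `P` into `Q`, that is, two pebbles are removed from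
some vertex `u` that has at least two, and one pebble is added at a neighbor `v` of `u`. -/
def Move (G : SimpleGraph V) (P Q : Distribution V) : Prop :=
  ∃ u v : V, G.Adj u v ∧ 2 ≤ P u ∧
    Q = Function.update (Function.update P u (P u - 2)) v (P v + 1)

/-- `Q` is obtained from `P` by some (possibly empty) executable sequence of pebbling moves. -/
def Reaches (G : SimpleGraph V) : Distribution V → Distribution V → Prop :=
  Relation.ReflTransGen (Move G)

/-- `v` is `k`-reachable under `P`. -/
def KReachable (G : SimpleGraph V) (k : ℕ) (P : Distribution V) (v : V) : Prop :=
  ∃ Q : Distribution V, Reaches G P Q ∧ k ≤ Q v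

/-- `v` is reachable under `P`. -/
def Reachable (G : SimpleGraph V) (P : Distribution V) (v : V) : Prop :=
  KReachable G 1 P v

/-- All vertices are reachable under `P`. -/
def Solvable (G : SimpleGraph V) (P : Distribution V) : Prop :=
  ∀ v : V, Reachable G P v

/-- The greatest `k` such that `v` is `k`-reachable under `P`
(it is a genuine maximum on a finite graph, see `isGreatest_reach`). -/
noncomputable def reach (G : SimpleGraph V) (P : Distribution V) (v : V) : ℕ :=
  sSup {k : ℕ | KReachable G k P v}

open Classical in
/-- The excess of `v` under `P`. -/
noncomputable def exc (G : SimpleGraph V) (P : Distribution V) (v : V) : ℕ :=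
  if Reachable G P v then reach G P v - 1 else 0

/-- The number of vertices that are reachable under `P`. -/
noncomputable def cov (G : SimpleGraph V) (P : Distribution V) : ℕ :=
  Set.ncard {v : V | Reachable G P v}

/-- `U` is a unit: exactly one vertex has pebbles under `U`. -/
def IsUnitDist (U : Distribution V) : Prop :=
  ∃! u : V, 0 < U u

/-- No vertex has pebbles under both distributions. -/
def DisjointDist (P Q : Distribution V) : Prop :=
  ∀ v : V, ¬ (0 < P v ∧ 0 < Q v)

/-- `U 0, …, U (t - 1)` is a decomposition of `P` into pairwise disjoint units. -/
structure IsUnitDecomposition {t : ℕ} (P : Distribution V) (U : Fin t → Distribution V) :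
    Prop where
  unit : ∀ i, IsUnitDist (U i)
  disjoint : ∀ i j, i ≠ j → DisjointDist (U i) (U j)
  sum_eq : ∑ i, U i = P

end

section

variable {V : Type*} [Fintype V]

/-- The size of a distribution: its total number of pebbles. -/
def size (P : Distribution V) : ℕ := ∑ v, P v

/-- The total excess of `P`. -/
noncomputable def TE (G : SimpleGraph V) (P : Distribution V) : ℕ := ∑ v, exc G P v

/-- The cooperation excess between `P` and `Q`, an integer. -/
noncomputable def CE (G : SimpleGraph V) (P Q : Distribution V) : ℤ :=
  (TE G (P + Q) : ℤ) - ((TE G P : ℤ) + (TE G Q : ℤ))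

theorem Move.size_le {G : SimpleGraph V} {P Q : Distribution V} (h : Move G P Q) :
    size Q ≤ size P := by
  classical
  obtain ⟨u, v, huv, hu, rfl⟩ := h
  have hne : v ≠ u := huv.ne'
  unfold size
  rw [Finset.sum_update_of_mem (Finset.mem_univ v),
    Finset.sum_update_of_mem (s := Finset.univ \ {v}) (by simpa using hne.symm)]
  have h1 := Finset.add_sum_erase Finset.univ P (Finset.mem_univ v)
  have h2 := Finset.add_sum_erase (Finset.univ.erase v) P (a := u) (by simpa using hne.symm)
  rw [Finset.sdiff_singleton_eq_erase, Finset.sdiff_singleton_eq_erase]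
  omega

theorem isGreatest_reach (G : SimpleGraph V) (P : Distribution V) (v : V) :
    IsGreatest {k : ℕ | KReachable G k P v} (reach G P v) := by
  have hb : BddAbove {k : ℕ | KReachable G k P v} := by
    refine ⟨size P, ?_⟩
    rintro k ⟨Q, hQ, hk⟩
    have hs : size Q ≤ size P := by
      clear hk
      induction hQ with
      | refl => exact le_rfl
      | tail _ h ih => exact h.size_le.trans ih
    exact hk.trans ((Finset.single_le_sum (f := Q) (fun _ _ => Nat.zero_le _)
      (Finset.mem_univ v)).trans hs)
  exact ⟨Nat.sSup_mem ⟨0, P, Relation.ReflTransGen.refl, Nat.zero_le _⟩ hb,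
    fun k hk => le_csSup hb hk⟩

end

end Pebbling

/-! The cooperation excesses telescope to TE(P) - Σ TE(U_i). Let r(v) be the reach of v under P,
s(v) the sum of its reaches under the units, and c(v) the number of units that reach v. The
difference is Σ (r - s + c - 1), and Σ cov(U_i) = Σ c. For d = Δ - 2 ≥ 1 the claim is therefore Σ
`val` ≥ 0 with `val` = d(r - s + c - 1) + c - 1 (`sum_val_nonneg`). For Δ < 2 the denominator is
negative, and r ≥ s together with r ≥ 1 suffices.

The inequality is proved by discharging. Only vertices in `IsL` have negative charge, namely -1, and
each has a neighbor in `IsH`, where it got its pebble. Every vertex of `IsH` sends 1 along each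
edge; as there are at most d + 2 edges, at least `base` remains. An edge to `IsL` pays for that
vertex, an edge to `IsE` may give its unit back, and the two units on an edge inside `IsH` are
divided by `ψ`. Before this division a vertex may lack 1 in `IsC`, 2 in `IsX` and 3 in `IsZ`.

Cheapest flows provide the remedy: in them the source of a move could get two pebbles with strictly
fewer moves, and this orders the vertices. A vertex of `IsZ` takes 2 from the edge to each earlier
neighbor. If there is just one, it asks that neighbor for 1 more; the neighbor must be able to
collect four pebbles, while no unit brings it more than one, so it can pay.

The vertices of `IsX` form trees along the parents from which their unit arrives. The edge to a
parent in `IsX` or `IsC` yields the missing 2, so only a root can lack anything: 1 if its parent is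
in `IsE`, 2 if it is the home of its unit. A cheapest flow that overfills a vertex of the tree
yields one unit (`exists_extra_edge`); a home finds two by itself or with that unit
(`exists_edge_of_single`, `exists_gain_of_home`). -/

namespace Pebbling

open Finset

variable {V : Type*}

/-! ### Move sequences and flows -/

/-- The flow consisting of a single move from `u` to `v`. -/
noncomputable def arc (u v : V) : V → V → ℕ := by
  classical exact fun a b => if a = u ∧ b = v then 1 else 0

open Classical in
theorem arc_apply (u v a b : V) : arc u v a b = if a = u ∧ b = v then 1 else 0 := by
  unfold arc
  congr

/-- `Exec G f P Q`: some executable sequence of moves in which each move `u → v` occurs `f u v` times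
turns `P` into `Q`. -/
inductive Exec (G : SimpleGraph V) : (V → V → ℕ) → Distribution V → Distribution V → Prop
  | nil (P : Distribution V) : Exec G 0 P P
  | snoc {f : V → V → ℕ} {P Q R : Distribution V} {u v : V} (h : Exec G f P Q) (huv : G.Adj u v)
      (hu : 2 ≤ Q u) (hRu : R u + 2 = Q u) (hRv : R v = Q v + 1)
      (hR : ∀ w, w ≠ u → w ≠ v → R w = Q w) : Exec G (f + arc u v) P R

theorem Move.spec {G : SimpleGraph V} {P Q : Distribution V} (h : Move G P Q) :
    ∃ u v, G.Adj u v ∧ 2 ≤ P u ∧ Q u + 2 = P u ∧ Q v = P v + 1 ∧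
      ∀ w, w ≠ u → w ≠ v → Q w = P w := by
  classical
  obtain ⟨u, v, huv, hu, rfl⟩ := h
  refine ⟨u, v, huv, hu, ?_, ?_, ?_⟩
  · rw [Function.update_of_ne huv.ne]
    simp only [Function.update_self]
    omega
  · simp
  · intro w h1 h2
    rw [Function.update_of_ne h2, Function.update_of_ne h1]

theorem Move.of_spec {G : SimpleGraph V} {P Q : Distribution V} {u v : V} (huv : G.Adj u v)
    (hu : 2 ≤ P u) (hQu : Q u + 2 = P u) (hQv : Q v = P v + 1)
    (hQ : ∀ w, w ≠ u → w ≠ v → Q w = P w) : Move G P Q := by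
  classical
  refine ⟨u, v, huv, hu, ?_⟩
  funext w
  by_cases h2 : w = v
  · subst h2
    rw [hQv, Function.update_self]
  · rw [Function.update_of_ne h2]
    by_cases h1 : w = u
    · subst h1
      simp only [Function.update_self]
      omega
    · rw [Function.update_of_ne h1, hQ w h1 h2]

theorem Exec.reaches {G : SimpleGraph V} {f : V → V → ℕ} {P Q : Distribution V}
    (h : Exec G f P Q) : Reaches G P Q := by
  induction h with
  | nil P => exact Relation.ReflTransGen.refl
  | snoc h huv hu h1 h2 h3 ih => exact ih.tail (Move.of_spec huv hu h1 h2 h3)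

theorem Reaches.exists_exec {G : SimpleGraph V} {P Q : Distribution V} (h : Reaches G P Q) :
    ∃ f, Exec G f P Q := by
  induction h with
  | refl => exact ⟨0, Exec.nil P⟩
  | tail _ hm ih =>
    obtain ⟨f, hf⟩ := ih
    obtain ⟨u, v, huv, hu, h1, h2, h3⟩ := hm.spec
    exact ⟨_, hf.snoc huv hu h1 h2 h3⟩

theorem Exec.cons {G : SimpleGraph V} {f : V → V → ℕ} {P P' Q : Distribution V} {u v : V}
    (huv : G.Adj u v) (hu : 2 ≤ P u) (hPu : P' u + 2 = P u) (hPv : P' v = P v + 1)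
    (hP : ∀ w, w ≠ u → w ≠ v → P' w = P w) (h : Exec G f P' Q) : Exec G (f + arc u v) P Q := by
  induction h with
  | nil P' => exact (Exec.nil P).snoc huv hu hPu hPv hP
  | snoc h huv' hu' h1 h2 h3 ih =>
    rw [add_right_comm]
    exact (ih hPu hPv hP).snoc huv' hu' h1 h2 h3

theorem exists_eq_add_smul_arc {f : V → V → ℕ} {u v : V} {m : ℕ} (h : m ≤ f u v) :
    ∃ g, f = g + m • arc u v := by
  refine ⟨fun a b => f a b - (m • arc u v) a b, ?_⟩
  funext a b
  simp only [Pi.add_apply, Pi.smul_apply, arc_apply, smul_eq_mul]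
  split_ifs with hab
  · obtain ⟨rfl, rfl⟩ := hab
    omega
  · simp

section Fin

variable [Fintype V]

/-- The number of moves of `f` into `v`. -/
def inflow (f : V → V → ℕ) (v : V) : ℕ := ∑ u, f u v

/-- The number of moves of `f` out of `v`. -/
def outflow (f : V → V → ℕ) (v : V) : ℕ := ∑ w, f v w

/-- The number of moves of `f`. -/
def total (f : V → V → ℕ) : ℕ := ∑ u, outflow f u

theorem total_eq_sum_inflow (f : V → V → ℕ) : total f = ∑ v, inflow f v :=
  Finset.sum_comm

theorem inflow_add (f g : V → V → ℕ) (v : V) : inflow (f + g) v = inflow f v + inflow g v :=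
  Finset.sum_add_distrib

theorem outflow_add (f g : V → V → ℕ) (v : V) : outflow (f + g) v = outflow f v + outflow g v :=
  Finset.sum_add_distrib

theorem total_add (f g : V → V → ℕ) : total (f + g) = total f + total g := by
  simp only [total, outflow_add, Finset.sum_add_distrib]

open Classical in
theorem inflow_smul_arc (m : ℕ) (u v w : V) :
    inflow (m • arc u v) w = if w = v then m else 0 := by
  simp only [inflow, Pi.smul_apply, arc_apply, smul_eq_mul]
  by_cases h : w = v <;> simp [h]

open Classical in
theorem outflow_smul_arc (m : ℕ) (u v w : V) :
    outflow (m • arc u v) w = if w = u then m else 0 := by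
  simp only [outflow, Pi.smul_apply, arc_apply, smul_eq_mul]
  by_cases h : w = u <;> simp [h]

theorem total_smul_arc (m : ℕ) (u v : V) : total (m • arc u v) = m := by
  classical
  simp only [total, outflow_smul_arc, Finset.sum_ite_eq', Finset.mem_univ, if_true]

theorem total_arc (u v : V) : total (arc u v) = 1 := by
  simpa using total_smul_arc 1 u v

theorem le_outflow (f : V → V → ℕ) (u v : V) : f u v ≤ outflow f u :=
  Finset.single_le_sum (f := fun v => f u v) (fun _ _ => Nat.zero_le _) (Finset.mem_univ v)

theorem exists_of_inflow_pos {f : V → V → ℕ} {v : V} (h : 0 < inflow f v) : ∃ u, 1 ≤ f u v := by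
  obtain ⟨u, -, hu⟩ := Finset.exists_ne_zero_of_sum_ne_zero h.ne'
  exact ⟨u, Nat.one_le_iff_ne_zero.mpr hu⟩

theorem exists_of_outflow_pos {f : V → V → ℕ} {v : V} (h : 0 < outflow f v) :
    ∃ w, 1 ≤ f v w := by
  obtain ⟨u, -, hu⟩ := Finset.exists_ne_zero_of_sum_ne_zero h.ne'
  exact ⟨u, Nat.one_le_iff_ne_zero.mpr hu⟩

/-- The moves of `f`, performed in whatever order, turn `P` into `Q`. -/
structure IsFlow (G : SimpleGraph V) (f : V → V → ℕ) (P Q : Distribution V) : Prop where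
  adj : ∀ u v, 1 ≤ f u v → G.Adj u v
  bal : ∀ v, Q v + 2 * outflow f v = P v + inflow f v

theorem Exec.isFlow {G : SimpleGraph V} {f : V → V → ℕ} {P Q : Distribution V}
    (h : Exec G f P Q) : IsFlow G f P Q := by
  classical
  induction h with
  | nil P => exact ⟨by simp, by simp [outflow, inflow]⟩
  | @snoc f P Q R u v h huv hu h1 h2 h3 ih =>
    refine ⟨fun a b hab => ?_, fun w => ?_⟩
    · simp only [Pi.add_apply, arc_apply] at hab
      split_ifs at hab with hh
      · rw [hh.1, hh.2]; exact huv
      · exact ih.adj a b hab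
    · have hb := ih.bal w
      have e1 := inflow_smul_arc 1 u v w
      have e2 := outflow_smul_arc 1 u v w
      rw [one_smul] at e1 e2
      rw [inflow_add, outflow_add, e1, e2]
      have hne := huv.ne
      by_cases hu' : w = u
      · subst hu'
        simp only [hne, if_true, if_false]
        omega
      · by_cases hv' : w = v
        · subst hv'
          simp only [hu', if_true, if_false]
          omega
        · simp only [hu', hv', if_false]
          rw [h3 w hu' hv']
          omega

/-- Executable moves of `f` are performed as long as there are any. When stuck, a vertex with
outflow holds at most one pebble, so outflow ≤ inflow everywhere. Both have the same sum, hence they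
agree, and the remaining moves would only lose pebbles. -/
theorem IsFlow.exists_exec {G : SimpleGraph V} {f : V → V → ℕ} {P Q : Distribution V}
    (h : IsFlow G f P Q) (v : V) :
    ∃ g R, Exec G g P R ∧ total g ≤ total f ∧ Q v ≤ R v := by
  classical
  induction hn : total f generalizing f P with
  | zero =>
    refine ⟨0, P, Exec.nil P, by simp [total, outflow], ?_⟩
    have h1 : inflow f v = 0 := by
      rw [total_eq_sum_inflow] at hn
      exact Finset.sum_eq_zero_iff.mp hn v (Finset.mem_univ v)
    have := h.bal v
    omega
  | succ n ih =>
    by_cases hex : ∃ u w, 1 ≤ f u w ∧ 2 ≤ P u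
    · obtain ⟨u, w, huw, hu⟩ := hex
      have hadj := h.adj u w huw
      have hne := hadj.ne
      obtain ⟨g, rfl⟩ := exists_eq_add_smul_arc huw
      let P' : Distribution V := Function.update (Function.update P u (P u - 2)) w (P w + 1)
      have hu' : P' u + 2 = P u := by
        simp only [P']
        rw [Function.update_of_ne hne]
        simp only [Function.update_self]
        omega
      have hw' : P' w = P w + 1 := by simp [P']
      have ho' : ∀ a, a ≠ u → a ≠ w → P' a = P a := fun a h1 h2 => by
        simp only [P']
        rw [Function.update_of_ne h2, Function.update_of_ne h1]
      have hfl : IsFlow G g P' Q := by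
        refine ⟨fun a b hab => h.adj a b (hab.trans (Nat.le_add_right _ _)), fun a => ?_⟩
        have hb := h.bal a
        rw [inflow_add, outflow_add, inflow_smul_arc, outflow_smul_arc] at hb
        by_cases h1 : a = u
        · subst h1
          simp only [hne, if_true, if_false] at hb
          omega
        · by_cases h2 : a = w
          · subst h2
            simp only [h1, if_true, if_false] at hb
            omega
          · simp only [h1, h2, if_false] at hb
            rw [ho' a h1 h2]
            omega
      have ht : total g = n := by
        rw [total_add, total_smul_arc] at hn
        omega
      obtain ⟨g', R, hex, htot, hR⟩ := ih hfl ht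
      refine ⟨g' + arc u w, R, hex.cons hadj hu hu' hw' ho', ?_, hR⟩
      rw [total_add, total_arc]
      omega
    · push Not at hex
      refine ⟨0, P, Exec.nil P, by simp [total, outflow], ?_⟩
      have hle : ∀ u, outflow f u ≤ inflow f u := by
        intro u
        rcases Nat.eq_zero_or_pos (outflow f u) with h0 | h0
        · omega
        · obtain ⟨w, hw⟩ := exists_of_outflow_pos h0
          have h1 := hex u w hw
          have h2 := h.bal u
          omega
      have heq : ∀ u ∈ Finset.univ, outflow f u = inflow f u := by
        rw [← Finset.sum_eq_sum_iff_of_le fun u _ => hle u]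
        exact total_eq_sum_inflow f
      have h1 := heq v (Finset.mem_univ v)
      have h2 := h.bal v
      omega

theorem Exec.exists_two_le {G : SimpleGraph V} {f : V → V → ℕ} {P Q : Distribution V}
    (h : Exec G f P Q) {w v : V} (hw : 1 ≤ f w v) :
    ∃ g R, Exec G g P R ∧ total g < total f ∧ 2 ≤ R w := by
  induction h with
  | nil P => simp at hw
  | @snoc f P Q R a b h huv hu h1 h2 h3 ih =>
    simp only [total_add, total_arc]
    by_cases hwa : w = a
    · subst hwa
      exact ⟨f, Q, h, Nat.lt_succ_self _, hu⟩
    · have : 1 ≤ f w v := by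
        simpa [arc_apply, hwa] using hw
      obtain ⟨g, R, h1, h2, h3⟩ := ih this
      exact ⟨g, R, h1, h2.trans (Nat.lt_succ_self _), h3⟩

theorem IsFlow.kReachable {G : SimpleGraph V} {f : V → V → ℕ} {P Q : Distribution V}
    (h : IsFlow G f P Q) {k : ℕ} {v : V} (hk : k ≤ Q v) : KReachable G k P v := by
  obtain ⟨g, R, he, -, hR⟩ := h.exists_exec v
  exact ⟨R, he.reaches, hk.trans hR⟩

theorem kReachable_iff {G : SimpleGraph V} {P : Distribution V} {k : ℕ} {v : V} :
    KReachable G k P v ↔ k ≤ reach G P v := by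
  refine ⟨fun h => (isGreatest_reach G P v).2 h, fun h => ?_⟩
  obtain ⟨Q, hQ, hk⟩ := (isGreatest_reach G P v).1
  exact ⟨Q, hQ, h.trans hk⟩

theorem IsFlow.le_reach {G : SimpleGraph V} {f : V → V → ℕ} {P Q : Distribution V}
    (h : IsFlow G f P Q) (v : V) : Q v ≤ reach G P v :=
  kReachable_iff.mp (h.kReachable le_rfl)

theorem exists_exec_reach (G : SimpleGraph V) (P : Distribution V) (v : V) :
    ∃ f Q, Exec G f P Q ∧ reach G P v ≤ Q v := by
  obtain ⟨Q, hQ, hk⟩ := (isGreatest_reach G P v).1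
  obtain ⟨f, hf⟩ := Reaches.exists_exec hQ
  exact ⟨f, Q, hf, hk⟩

theorem reachable_iff {G : SimpleGraph V} {P : Distribution V} {v : V} :
    Reachable G P v ↔ 1 ≤ reach G P v :=
  kReachable_iff

theorem le_reach_self (G : SimpleGraph V) (P : Distribution V) (v : V) : P v ≤ reach G P v :=
  (Exec.nil P).isFlow.le_reach v

theorem IsFlow.add {G : SimpleGraph V} {f g : V → V → ℕ} {P Q P' Q' : Distribution V}
    (h : IsFlow G f P Q) (h' : IsFlow G g P' Q') : IsFlow G (f + g) (P + P') (Q + Q') := by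
  refine ⟨fun u v huv => ?_, fun v => ?_⟩
  · have huv' : 1 ≤ f u v + g u v := huv
    rcases Nat.eq_zero_or_pos (f u v) with h0 | h0
    · exact h'.adj u v (by omega)
    · exact h.adj u v h0
  · have h1 := h.bal v
    have h2 := h'.bal v
    rw [inflow_add, outflow_add, Pi.add_apply, Pi.add_apply]
    omega

theorem reach_add_le (G : SimpleGraph V) (P Q : Distribution V) (v : V) :
    reach G P v + reach G Q v ≤ reach G (P + Q) v := by
  obtain ⟨f, P', hf, h1⟩ := exists_exec_reach G P v
  obtain ⟨g, Q', hg, h2⟩ := exists_exec_reach G Q v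
  exact (Nat.add_le_add h1 h2).trans ((hf.isFlow.add hg.isFlow).le_reach v)

theorem sum_reach_le {ι : Type*} (G : SimpleGraph V) (s : Finset ι) (U : ι → Distribution V)
    (v : V) : ∑ i ∈ s, reach G (U i) v ≤ reach G (∑ i ∈ s, U i) v := by
  classical
  induction s using Finset.induction_on with
  | empty => simp
  | insert a s ha ih =>
    rw [Finset.sum_insert ha, Finset.sum_insert ha]
    exact (Nat.add_le_add_left ih _).trans (reach_add_le G _ _ v)

theorem IsFlow.add_smul_arc {G : SimpleGraph V} {f : V → V → ℕ} {P Q : Distribution V}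
    (h : IsFlow G f P Q) {u v : V} (huv : G.Adj u v) {m : ℕ} (hm : 2 * m ≤ Q u) :
    ∃ R, IsFlow G (f + m • arc u v) P R ∧ m ≤ R v := by
  classical
  have hne := huv.ne
  refine ⟨fun w => Q w + (if w = v then m else 0) - 2 * (if w = u then m else 0),
    ⟨fun a b hab => ?_, fun w => ?_⟩, ?_⟩
  · simp only [Pi.add_apply, Pi.smul_apply, arc_apply, smul_eq_mul] at hab
    split_ifs at hab with hh
    · rw [hh.1, hh.2]; exact huv
    · exact h.adj a b (by simpa using hab)
  · have hb := h.bal w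
    rw [inflow_add, outflow_add, inflow_smul_arc, outflow_smul_arc]
    by_cases h1 : w = u
    · subst h1
      simp only [if_true, hne, if_false]
      omega
    · simp only [h1, if_false]
      split_ifs <;> omega
  · simp [hne.symm]

theorem reach_div_two_le {G : SimpleGraph V} {P : Distribution V} {u v : V} (huv : G.Adj u v) :
    reach G P u / 2 ≤ reach G P v := by
  obtain ⟨f, Q, hf, h⟩ := exists_exec_reach G P u
  obtain ⟨R, hR, hm⟩ := hf.isFlow.add_smul_arc huv (m := reach G P u / 2) (by omega)
  exact hm.trans (hR.le_reach v)

/-! ### Cheapest flows -/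

/-- The least number of moves that bring `k` pebbles to `v`. -/
noncomputable def cost (G : SimpleGraph V) (P : Distribution V) (k : ℕ) (v : V) : ℕ :=
  sInf {n | ∃ f Q, Exec G f P Q ∧ k ≤ Q v ∧ total f = n}

theorem IsFlow.cost_le {G : SimpleGraph V} {f : V → V → ℕ} {P Q : Distribution V}
    (h : IsFlow G f P Q) {k : ℕ} {v : V} (hk : k ≤ Q v) : cost G P k v ≤ total f := by
  obtain ⟨g, R, he, ht, hR⟩ := h.exists_exec v
  have hmem : total g ∈ {n | ∃ f Q, Exec G f P Q ∧ k ≤ Q v ∧ total f = n} :=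
    ⟨g, R, he, hk.trans hR, rfl⟩
  exact (Nat.sInf_le hmem).trans ht

/-- `f` is a cheapest way to bring `k` pebbles to `v`. -/
structure IsMinFlow (G : SimpleGraph V) (P : Distribution V) (k : ℕ) (v : V) (f : V → V → ℕ)
    (Q : Distribution V) : Prop where
  exec : Exec G f P Q
  le : k ≤ Q v
  total_eq : total f = cost G P k v

theorem exists_isMinFlow {G : SimpleGraph V} {P : Distribution V} {k : ℕ} {v : V}
    (h : k ≤ reach G P v) : ∃ f Q, IsMinFlow G P k v f Q := by
  obtain ⟨f, Q, hf, hk⟩ := exists_exec_reach G P v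
  have hne : {n | ∃ f Q, Exec G f P Q ∧ k ≤ Q v ∧ total f = n}.Nonempty :=
    ⟨_, f, Q, hf, h.trans hk, rfl⟩
  obtain ⟨g, R, h1, h2, h3⟩ := Nat.sInf_mem hne
  exact ⟨g, R, h1, h2, h3⟩

/-- The bound by `reach` is needed: an unattainable amount has cost `sInf ∅ = 0`. -/
theorem cost_mono {G : SimpleGraph V} {P : Distribution V} {k l : ℕ} {v : V} (hkl : k ≤ l)
    (h : l ≤ reach G P v) : cost G P k v ≤ cost G P l v := by
  obtain ⟨f, Q, hf⟩ := exists_isMinFlow h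
  exact (hf.exec.isFlow.cost_le (hkl.trans hf.le)).trans hf.total_eq.le

namespace IsMinFlow

variable {G : SimpleGraph V} {P Q : Distribution V} {k : ℕ} {y : V} {f : V → V → ℕ}

theorem adj (h : IsMinFlow G P k y f Q) {u v : V} (huv : 1 ≤ f u v) : G.Adj u v :=
  h.exec.isFlow.adj u v huv

/-- Just before a move out of `w` is made, `w` holds two pebbles and that move is not yet counted.
This strictness drives the later minimality arguments. -/
theorem source (h : IsMinFlow G P k y f Q) {w v : V} (hw : 1 ≤ f w v) :
    2 ≤ reach G P w ∧ cost G P 2 w < cost G P k y := by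
  obtain ⟨g, R, he, ht, hR⟩ := h.exec.exists_two_le hw
  exact ⟨hR.trans (he.isFlow.le_reach w),
    (he.isFlow.cost_le hR).trans_lt (ht.trans_eq h.total_eq)⟩

theorem le_inflow_add (h : IsMinFlow G P k y f Q) : k ≤ P y + inflow f y := by
  have h1 := h.exec.isFlow.bal y
  have h2 := h.le
  omega

theorem exists_into (h : IsMinFlow G P k y f Q) (hP : P y < k) : ∃ w, 1 ≤ f w y := by
  have := h.le_inflow_add
  exact exists_of_inflow_pos (by omega)

/-- Cancelling `m` moves from `q` to `y` leaves `2 * m` more pebbles at `q`; the `m` pebbles lost at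
`y` are there because `m ≤ k`. -/
theorem of_le_source (h : IsMinFlow G P k y f Q) {q : V} {m : ℕ} (hm : 1 ≤ m) (hmk : m ≤ k)
    (hq : m ≤ f q y) : 2 * m ≤ reach G P q ∧ cost G P (2 * m) q < cost G P k y := by
  classical
  have hne := (h.adj (hm.trans hq)).ne
  obtain ⟨g, rfl⟩ := exists_eq_add_smul_arc hq
  have hfl : IsFlow G g P (fun w => Q w + 2 * (if w = q then m else 0) - if w = y then m else 0) := by
    refine ⟨fun a b hab => h.exec.isFlow.adj a b (hab.trans (Nat.le_add_right _ _)), fun w => ?_⟩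
    have hb := h.exec.isFlow.bal w
    have hle := h.le
    rw [inflow_add, outflow_add, inflow_smul_arc, outflow_smul_arc] at hb
    by_cases h1 : w = y
    · subst h1
      simp only [if_true, hne.symm, if_false] at hb ⊢
      omega
    · simp only [h1, if_false] at hb ⊢
      split_ifs at hb ⊢ <;> omega
  have hle : 2 * m ≤ Q q + 2 * (if q = q then m else 0) - if q = y then m else 0 := by
    simp [hne]
  have ht := h.total_eq
  rw [total_add, total_smul_arc] at ht
  exact ⟨hle.trans (hfl.le_reach q), (hfl.cost_le hle).trans_lt (by omega)⟩

theorem of_sole_source (h : IsMinFlow G P k y f Q) {q : V} (hP : P y < k)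
    (hq : ∀ w, 1 ≤ f w y → w = q) :
    2 * (k - P y) ≤ reach G P q ∧ cost G P (2 * (k - P y)) q < cost G P k y := by
  have h1 : inflow f y = f q y := by
    unfold inflow
    refine Finset.sum_eq_single q (fun w _ hw => ?_) (by simp)
    by_contra h0
    exact hw (hq w (Nat.one_le_iff_ne_zero.mpr h0))
  have h2 := h.le_inflow_add
  exact h.of_le_source (by omega) (by omega) (by omega)

/-- Deleting a move together with its opposite gains one pebble at each end and saves two moves. -/
theorem not_opposite (h : IsMinFlow G P k y f Q) {u v : V} (huv : 1 ≤ f u v) : f v u = 0 := by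
  classical
  by_contra h0
  have hvu : 1 ≤ f v u := Nat.one_le_iff_ne_zero.mpr h0
  have hne := (h.adj huv).ne
  obtain ⟨g, rfl⟩ := exists_eq_add_smul_arc huv
  have hvu' : 1 ≤ g v u := by
    simpa [arc_apply, hne.symm] using hvu
  obtain ⟨g, rfl⟩ := exists_eq_add_smul_arc hvu'
  have hfl : IsFlow G g P
      (fun w => Q w + (if w = u then 1 else 0) + if w = v then 1 else 0) := by
    refine ⟨fun a b hab => h.exec.isFlow.adj a b
      ((hab.trans (Nat.le_add_right _ _)).trans (Nat.le_add_right _ _)), fun w => ?_⟩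
    have hb := h.exec.isFlow.bal w
    simp only [inflow_add, outflow_add, inflow_smul_arc, outflow_smul_arc] at hb
    split_ifs at hb ⊢ <;> omega
  have hle := hfl.cost_le (v := y) (k := k)
    (h.le.trans ((Nat.le_add_right _ _).trans (Nat.le_add_right _ _)))
  have ht := h.total_eq
  simp only [total_add, total_smul_arc] at ht
  omega

theorem exists_into_of_out (h : IsMinFlow G P k y f Q) {w v : V} (hw : 1 ≤ f w v)
    (hP : P w = 0) : ∃ u, 1 ≤ f u w := by
  have h1 := h.exec.isFlow.bal w
  have h2 := le_outflow f w v
  exact exists_of_inflow_pos (by omega)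

end IsMinFlow

end Fin

/-! ### The reach of a single unit -/

section Units

variable {V : Type*} [Fintype V]

/-- A move from `u` to `v` trades weight `2 * w u` for `w v`, so the total weight never grows. -/
theorem IsFlow.sum_mul_le {G : SimpleGraph V} {f : V → V → ℕ} {P Q : Distribution V}
    (h : IsFlow G f P Q) (w : V → ℚ) (hw : ∀ u v, G.Adj u v → w v ≤ 2 * w u) :
    ∑ v, w v * Q v ≤ ∑ v, w v * P v := by
  have h1 : ∀ v, w v * Q v = w v * P v + (w v * inflow f v - 2 * w v * outflow f v) := by
    intro v
    have hb : (Q v : ℚ) + 2 * outflow f v = P v + inflow f v := by exact_mod_cast h.bal v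
    linear_combination w v * hb
  have h2 : ∑ v, w v * inflow f v ≤ ∑ v, 2 * w v * outflow f v := by
    simp only [inflow, outflow, Nat.cast_sum, Finset.mul_sum]
    rw [Finset.sum_comm]
    refine Finset.sum_le_sum fun u _ => Finset.sum_le_sum fun v _ => ?_
    rcases Nat.eq_zero_or_pos (f u v) with h0 | h0
    · simp [h0]
    · exact mul_le_mul_of_nonneg_right (hw u v (h.adj u v h0)) (Nat.cast_nonneg _)
  rw [Finset.sum_congr rfl fun v _ => h1 v, Finset.sum_add_distrib, Finset.sum_sub_distrib]
  linarith

-- The weight is `2 ^ (-dist)` to `v` on the component of `v`, and 0 elsewhere.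
open Classical in
theorem two_pow_dist_mul_reach_le {G : SimpleGraph V} {U : Distribution V} {x : V}
    (hU : ∀ w, w ≠ x → U w = 0) (v : V) :
    2 ^ G.dist x v * reach G U v ≤ if G.Reachable x v then U x else 0 := by
  obtain ⟨f, Q, hf, hQ⟩ := exists_exec_reach G U v
  have key := hf.isFlow.sum_mul_le
    (fun u => if G.Reachable u v then (1 / 2 : ℚ) ^ G.dist u v else 0) (by
      intro a b hab
      by_cases hb : G.Reachable b v
      · have ha : G.Reachable a v := hab.reachable.trans hb
        simp only [ha, hb, if_true]
        obtain ⟨p, hp⟩ := hb.exists_walk_length_eq_dist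
        have hd : G.dist a v ≤ G.dist b v + 1 := by
          rw [← hp]
          exact SimpleGraph.dist_le (SimpleGraph.Walk.cons hab p)
        have := pow_le_pow_of_le_one (by norm_num : (0 : ℚ) ≤ 1 / 2) (by norm_num) hd
        rw [pow_succ] at this
        linarith
      · simp only [hb, if_false]
        positivity)
  have hr : ∑ u, (if G.Reachable u v then (1 / 2 : ℚ) ^ G.dist u v else 0) * U u =
      (if G.Reachable x v then (1 / 2 : ℚ) ^ G.dist x v else 0) * U x :=
    Finset.sum_eq_single x (fun u _ hu => by simp [hU u hu]) (by simp)
  have hl : (Q v : ℚ) ≤ ∑ u, (if G.Reachable u v then (1 / 2 : ℚ) ^ G.dist u v else 0) * Q u := by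
    refine le_trans (by simp) (Finset.single_le_sum
      (f := fun u => (if G.Reachable u v then (1 / 2 : ℚ) ^ G.dist u v else 0) * Q u)
      (fun u _ => by positivity) (Finset.mem_univ v))
  have hfin : (reach G U v : ℚ) ≤
      (if G.Reachable x v then (1 / 2 : ℚ) ^ G.dist x v else 0) * U x := by
    rw [← hr]
    exact le_trans (by exact_mod_cast hQ) (hl.trans key)
  have : (2 : ℚ) ^ G.dist x v * reach G U v ≤ ((if G.Reachable x v then U x else 0 : ℕ) : ℚ) := by
    refine (mul_le_mul_of_nonneg_left hfin (by positivity)).trans ?_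
    split_ifs
    · rw [← mul_assoc, ← mul_pow]
      norm_num
    · simp
  exact_mod_cast this

theorem reach_div_two_pow_le {G : SimpleGraph V} {P : Distribution V} {u v : V} (p : G.Walk u v) :
    reach G P u / 2 ^ p.length ≤ reach G P v := by
  induction p with
  | nil => simp
  | cons h p ih =>
    rw [SimpleGraph.Walk.length_cons, pow_succ', ← Nat.div_div_eq_div_mul]
    exact (Nat.div_le_div_right (reach_div_two_le h)).trans ih

theorem reach_unit_self {G : SimpleGraph V} {U : Distribution V} {x : V}
    (hU : ∀ w, w ≠ x → U w = 0) : reach G U x = U x :=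
  le_antisymm (by simpa using two_pow_dist_mul_reach_le (G := G) hU x) (le_reach_self G U x)

/-- The pebbles of a unit arrive at `v` along a neighbor of `v` which is closer to the unit. -/
theorem exists_pred {G : SimpleGraph V} {U : Distribution V} {x : V}
    (hU : ∀ w, w ≠ x → U w = 0) {v : V} (hv : v ≠ x) (hr : 1 ≤ reach G U v) :
    ∃ p, G.Adj v p ∧ 2 * reach G U v ≤ reach G U p ∧ (G.Adj v x → p = x) := by
  have hle := two_pow_dist_mul_reach_le (G := G) hU v
  have hreach : G.Reachable v x := by
    by_contra hcon
    have hcon' : ¬ G.Reachable x v := fun h => hcon h.symm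
    rw [if_neg hcon'] at hle
    have : 0 < 2 ^ G.dist x v * reach G U v := by positivity
    omega
  rw [if_pos hreach.symm] at hle
  obtain ⟨p, hp⟩ := hreach.exists_walk_length_eq_dist
  rw [SimpleGraph.dist_comm] at hp
  cases p with
  | nil => exact absurd rfl hv
  | @cons _ b _ h q =>
    rw [SimpleGraph.Walk.length_cons] at hp
    -- `b` follows `v` on a shortest walk to `x`. Walking from `x` to `b` halves one time less than
    -- the distance of `v`, which leaves twice the reach of `v`.
    refine ⟨b, h, ?_, fun hvx => ?_⟩
    · have h1 := reach_div_two_pow_le (P := U) q.reverse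
      rw [SimpleGraph.Walk.length_reverse] at h1
      refine le_trans ?_ h1
      rw [Nat.le_div_iff_mul_le (by positivity)]
      refine le_trans (le_of_eq ?_) (hle.trans (le_reach_self G U x))
      rw [← hp, pow_succ]
      ring
    · have h1 : G.dist x v = 1 := SimpleGraph.dist_eq_one_iff_adj.mpr hvx.symm
      have : q.length = 0 := by omega
      exact SimpleGraph.Walk.eq_of_length_eq_zero this

end Units

theorem reach_unit_le {V : Type*} [Fintype V] {G : SimpleGraph V} {U : Distribution V} {x : V}
    (hU : ∀ w, w ≠ x → U w = 0) (v : V) : reach G U v ≤ U x := by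
  classical
  have h := two_pow_dist_mul_reach_le (G := G) hU v
  refine (Nat.le_mul_of_pos_left _ (by positivity)).trans (h.trans ?_)
  split_ifs <;> simp

/-! ### Unit systems, types of vertices and the division of edges -/

open Classical in
/-- Disjoint units on a graph of maximum degree at most `d + 2`, whose sum is solvable. -/
structure UnitSystem (V ι : Type*) [Fintype V] [Fintype ι] where
  /-- The graph. -/
  G : SimpleGraph V
  /-- The units. -/
  U : ι → Distribution V
  /-- The vertices on which the units live. -/
  home : ι → V
  eq_zero : ∀ i w, w ≠ home i → U i w = 0
  one_le : ∀ i, 1 ≤ U i (home i)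
  home_inj : Function.Injective home
  solvable : ∀ v, 1 ≤ reach G (∑ i, U i) v
  /-- The maximum degree minus two. -/
  d : ℕ
  one_le_d : 1 ≤ d
  card_le : ∀ v, #{w | G.Adj v w} ≤ d + 2

namespace UnitSystem

section Defs

open scoped Classical

variable {V ι : Type*} [Fintype V] [Fintype ι] (S : UnitSystem V ι)

/-- The sum of the units. -/
def P : Distribution V := ∑ i, S.U i

/-- The reach of `v` under the sum of the units. -/
noncomputable def r (v : V) : ℕ := reach S.G S.P v

/-- The reach of `v` under the unit `i`. -/
noncomputable def ri (i : ι) (v : V) : ℕ := reach S.G (S.U i) v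

/-- The total reach of `v` under the single units. -/
noncomputable def s (v : V) : ℕ := ∑ i, S.ri i v

/-- The number of units that reach `v`. -/
noncomputable def c (v : V) : ℕ := #{i | 1 ≤ S.ri i v}

/-- The least number of moves that bring `k` pebbles to `v`. -/
noncomputable def τ (k : ℕ) (v : V) : ℕ := cost S.G S.P k v

/-- `v` is reached by several units. -/
def IsC (v : V) : Prop := 2 ≤ S.c v

/-- `v` is reached by one unit, and cooperation brings it more. -/
def IsX (v : V) : Prop := S.c v = 1 ∧ S.s v < S.r v

/-- `v` is reached by one unit, and cooperation brings it nothing. -/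
def IsE (v : V) : Prop := S.c v = 1 ∧ S.r v = S.s v

/-- `v` is reached by no unit, but cooperation brings it at least two pebbles. -/
def IsZ (v : V) : Prop := S.c v = 0 ∧ 2 ≤ S.r v

/-- `v` is reached by no unit, and cooperation brings it one pebble only. -/
def IsL (v : V) : Prop := S.c v = 0 ∧ S.r v = 1

/-- The neighbor `w` of `v` can get two pebbles before `v` can. -/
def Earlier (v w : V) : Prop := S.G.Adj v w ∧ 2 ≤ S.r w ∧ S.τ 2 w < S.τ 2 v

/-- `v` asks its neighbor `w` for support. -/
def Ask (v w : V) : Prop := S.IsZ v ∧ ∀ u, S.Earlier v u ↔ u = w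

/-- The number of neighbors that ask `v` for support. -/
noncomputable def asks (v : V) : ℕ := #{w | S.Ask w v}

/-- `p` is a neighbor of `v` along which the pebbles of the unit `j` arrive at `v`. -/
def IsPred (j : ι) (v p : V) : Prop :=
  1 ≤ S.ri j v ∧ v ≠ S.home j ∧ S.G.Adj v p ∧ 2 * S.ri j v ≤ S.ri j p ∧
    (S.G.Adj v (S.home j) → p = S.home j)

/-- A neighbor along which the pebbles of some unit arrive at `v`, and `v` if there is none. -/
noncomputable def par (v : V) : V := if h : ∃ p j, S.IsPred j v p then h.choose else v

/-- `v`, reached by two units, needs support from `par v`. -/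
def Wants (v : V) : Prop := S.c v = 2 ∧ S.d * (S.r v - S.s v) < 1 + S.asks v

/-- Some unit reaches both `v` and `w`. -/
def Share (v w : V) : Prop := ∃ i, 1 ≤ S.ri i v ∧ 1 ≤ S.ri i w

/-- The share of `v` in the two units of charge on the edge `vw`. -/
noncomputable def ψ (v w : V) : ℤ :=
  if S.IsZ v then
    if S.Earlier v w then (if S.Ask v w then 3 else 2) else if S.Ask w v then -1 else 0
  else if S.IsX v then
    if S.IsE w then 1
    else if S.IsZ w then (if S.Ask w v then -1 else if S.τ 2 w < S.τ 2 v then 2 else 0)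
    else if S.IsX w then
      -- A child takes both units of the edge to its parent. Otherwise a common unit means equal
      -- shares, and without one the later vertex takes both.
      if S.par v = w then 2 else if S.par w = v then 0 else if S.Share v w then 1
      else if S.τ 2 w < S.τ 2 v then 2 else 0
    else if S.IsC w then (if S.Wants w ∧ S.par w = v then 1 else 2) else 0
  else if S.IsC v then
    if S.IsE w ∨ S.IsC w then 1
    else if S.IsZ w then (if S.Ask w v then -1 else 0)
    else if S.IsX w then (if S.Wants v ∧ S.par v = w then 1 else 0) else 0
  else 0

/-- `ψ` without the support given. -/
noncomputable def φ (v w : V) : ℤ := S.ψ v w + if S.Ask w v then 1 else 0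

/-- The spare charge of a vertex in `IsX`. -/
noncomputable def bonus (v : V) : ℤ := S.d * ((S.r v : ℤ) - S.s v - 1) - S.asks v

end Defs

/-! ### Counts, reaches and parents -/

variable {V ι : Type*} [Fintype V] [Fintype ι] {S : UnitSystem V ι} {v w : V} {i j : ι}

theorem s_le_r (S : UnitSystem V ι) (v : V) : S.s v ≤ S.r v :=
  sum_reach_le S.G Finset.univ S.U v

theorem one_le_r (S : UnitSystem V ι) (v : V) : 1 ≤ S.r v := S.solvable v

theorem ri_div_two_le (h : S.G.Adj v w) : S.ri i v / 2 ≤ S.ri i w := reach_div_two_le h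

theorem ri_home (S : UnitSystem V ι) (i : ι) : S.ri i (S.home i) = S.U i (S.home i) :=
  reach_unit_self (S.eq_zero i)

theorem ri_le (S : UnitSystem V ι) (i : ι) (v : V) : S.ri i v ≤ S.ri i (S.home i) := by
  rw [ri_home]
  exact reach_unit_le (S.eq_zero i) v

theorem P_apply (S : UnitSystem V ι) (v : V) : S.P v = ∑ i, S.U i v := by
  rw [P, Finset.sum_apply]

theorem P_eq_zero (h : ∀ i, v ≠ S.home i) : S.P v = 0 := by
  rw [P_apply]
  exact Finset.sum_eq_zero fun i _ => S.eq_zero i v (h i)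

theorem P_home (S : UnitSystem V ι) (j : ι) : S.P (S.home j) = S.ri j (S.home j) := by
  rw [P_apply, ri_home]
  exact Finset.sum_eq_single j (fun i _ hi => S.eq_zero i _ fun h => hi (S.home_inj h).symm)
    (by simp)

theorem one_le_ri_home (S : UnitSystem V ι) (j : ι) : 1 ≤ S.ri j (S.home j) := by
  rw [ri_home]
  exact S.one_le j

theorem P_le_s (S : UnitSystem V ι) (v : V) : S.P v ≤ S.s v := by
  rw [P_apply]
  exact Finset.sum_le_sum fun i _ => le_reach_self _ _ _

theorem P_le_one (h : ∀ i, S.ri i v ≤ 1) : S.P v ≤ 1 := by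
  by_cases hv : ∃ j, v = S.home j
  · obtain ⟨j, rfl⟩ := hv
    rw [P_home]
    exact h j
  · push Not at hv
    rw [P_eq_zero hv]
    exact Nat.zero_le 1

theorem c_le_s (S : UnitSystem V ι) (v : V) : S.c v ≤ S.s v := by
  classical
  unfold c s
  rw [Finset.card_filter]
  refine Finset.sum_le_sum fun i _ => ?_
  split_ifs <;> omega

theorem s_eq_c (h : ∀ i, S.ri i v ≤ 1) : S.s v = S.c v := by
  classical
  unfold c s
  rw [Finset.card_filter]
  refine Finset.sum_congr rfl fun i _ => ?_
  have := h i
  split_ifs <;> omega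

theorem ri_eq_zero (h : S.c v = 0) (i : ι) : S.ri i v = 0 := by
  classical
  have := Finset.filter_eq_empty_iff.mp (Finset.card_eq_zero.mp h) (Finset.mem_univ i)
  omega

theorem s_eq_zero (h : S.c v = 0) : S.s v = 0 :=
  Finset.sum_eq_zero fun i _ => ri_eq_zero h i

theorem one_le_c (h : 1 ≤ S.ri i v) : 1 ≤ S.c v := by
  by_contra hcon
  have := ri_eq_zero (S := S) (v := v) (by omega) i
  omega

theorem exists_unit (h : S.c v = 1) :
    ∃ j, 1 ≤ S.ri j v ∧ (∀ i, 1 ≤ S.ri i v → i = j) ∧ S.s v = S.ri j v := by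
  classical
  obtain ⟨j, hj⟩ := Finset.card_eq_one.mp h
  have hmem : ∀ i, 1 ≤ S.ri i v ↔ i = j := fun i => by
    have : i ∈ ({i | 1 ≤ S.ri i v} : Finset ι) ↔ i ∈ ({j} : Finset ι) := by rw [hj]
    simpa using this
  refine ⟨j, (hmem j).mpr rfl, fun i hi => (hmem i).mp hi, ?_⟩
  refine Finset.sum_eq_single j (fun i _ hi => ?_) (by simp)
  by_contra h0
  exact hi ((hmem i).mp (by omega))

theorem s_eq_ri (h : S.c v = 1) (hj : 1 ≤ S.ri j v) : S.s v = S.ri j v := by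
  obtain ⟨i, -, hi, hs⟩ := exists_unit h
  rw [hi j hj, hs]

theorem unit_unique (h : S.c v = 1) (hj : 1 ≤ S.ri j v) (hi : 1 ≤ S.ri i v) : i = j := by
  obtain ⟨k, -, hk, -⟩ := exists_unit h
  rw [hk i hi, hk j hj]

theorem exists_two_units (h : S.c v = 2) (hj : 1 ≤ S.ri j v) :
    ∃ i, i ≠ j ∧ 1 ≤ S.ri i v ∧ S.s v = S.ri i v + S.ri j v := by
  classical
  have hmem : j ∈ ({i | 1 ≤ S.ri i v} : Finset ι) := by simpa using hj
  have hcard : #(({i | 1 ≤ S.ri i v} : Finset ι).erase j) = 1 := by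
    rw [Finset.card_erase_of_mem hmem]
    have : #({i | 1 ≤ S.ri i v} : Finset ι) = 2 := h
    omega
  obtain ⟨i, hi⟩ := Finset.card_eq_one.mp hcard
  have hmem' : ∀ k, (k ≠ j ∧ 1 ≤ S.ri k v) ↔ k = i := fun k => by
    have : k ∈ (({i | 1 ≤ S.ri i v} : Finset ι).erase j) ↔ k ∈ ({i} : Finset ι) := by rw [hi]
    simpa using this
  obtain ⟨hij, hi1⟩ := (hmem' i).mpr rfl
  refine ⟨i, hij, hi1, ?_⟩
  have hsum : S.s v = ∑ k ∈ ({i, j} : Finset ι), S.ri k v := by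
    refine (Finset.sum_subset (Finset.subset_univ _) fun k _ hk => ?_).symm
    simp only [Finset.mem_insert, Finset.mem_singleton, not_or] at hk
    by_contra h0
    exact hk.1 ((hmem' k).mp ⟨hk.2, by omega⟩)
  rw [hsum, Finset.sum_pair hij]

theorem cases_c (S : UnitSystem V ι) (v : V) :
    S.IsC v ∨ S.IsX v ∨ S.IsE v ∨ S.IsZ v ∨ S.IsL v := by
  unfold IsC IsX IsE IsZ IsL
  have h1 := S.s_le_r v
  have h2 := S.one_le_r v
  omega

theorem par_spec (S : UnitSystem V ι) (v : V) :
    (∃ j, S.IsPred j v (S.par v)) ∨ S.par v = v ∧ ∀ j, 1 ≤ S.ri j v → v = S.home j := by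
  unfold par
  split_ifs with h
  · exact Or.inl h.choose_spec
  · refine Or.inr ⟨rfl, fun j hj => ?_⟩
    by_contra hne
    obtain ⟨p, hp⟩ := exists_pred (S.eq_zero j) hne hj
    exact h ⟨p, j, hj, hne, hp⟩

theorem IsPred.one_le_c {p : V} (h : S.IsPred j v p) : 1 ≤ S.c p :=
  UnitSystem.one_le_c (i := j) (by have := h.1; have := h.2.2.2.1; omega)

/-- A vertex reached by exactly one unit is its home, or not pebbled. -/
theorem cases_par (h : S.c v = 1) : ∃ j, 1 ≤ S.ri j v ∧ S.s v = S.ri j v ∧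
    ((v = S.home j ∧ S.par v = v ∧ S.P v = S.ri j v) ∨
      (S.par v ≠ v ∧ S.P v = 0 ∧ S.IsPred j v (S.par v))) := by
  rcases S.par_spec v with ⟨j, hj⟩ | ⟨h1, h2⟩
  · refine ⟨j, hj.1, s_eq_ri h hj.1, Or.inr ⟨hj.2.2.1.ne', P_eq_zero fun i hi => ?_, hj⟩⟩
    have : i = j := unit_unique h hj.1 (by rw [hi]; exact S.one_le_ri_home i)
    exact hj.2.1 (this ▸ hi)
  · obtain ⟨j, hj, -, hs⟩ := exists_unit h
    have hv := h2 j hj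
    refine ⟨j, hj, hs, Or.inl ⟨hv, h1, ?_⟩⟩
    rw [hv, P_home]

theorem par_isPred (h : S.c v = 1) (hp : S.par v ≠ v) :
    ∃ j, 1 ≤ S.ri j v ∧ S.s v = S.ri j v ∧ S.P v = 0 ∧ S.IsPred j v (S.par v) := by
  obtain ⟨j, h1, h2, h3⟩ := cases_par h
  rcases h3 with h3 | h3
  · exact absurd h3.2.1 hp
  · exact ⟨j, h1, h2, h3.2.1, h3.2.2⟩

theorem IsC.par_isPred (h : S.IsC v) : ∃ j, S.IsPred j v (S.par v) := by
  rcases S.par_spec v with hj | ⟨-, h2⟩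
  · exact hj
  · exfalso
    obtain ⟨a, ha, b, hb, hab⟩ := Finset.one_lt_card.mp h
    simp only [Finset.mem_filter, Finset.mem_univ, true_and] at ha hb
    exact hab (S.home_inj ((h2 a ha).symm.trans (h2 b hb)))

theorem IsZ.P_eq_zero (h : S.IsZ v) : S.P v = 0 := by
  have h1 := S.P_le_s v
  rw [s_eq_zero h.1] at h1
  omega

theorem IsZ.exists_earlier (h : S.IsZ v) : ∃ w, S.Earlier v w := by
  obtain ⟨f, Q, hf⟩ := exists_isMinFlow (G := S.G) (P := S.P) (k := 2) (v := v) h.2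
  obtain ⟨w, hw⟩ := hf.exists_into (by rw [h.P_eq_zero]; norm_num)
  exact ⟨w, (hf.adj hw).symm, hf.source hw⟩

/-! ### Requests for support -/

theorem Ask.earlier (h : S.Ask w v) : S.Earlier w v := (h.2 v).mpr rfl

theorem Ask.adj (h : S.Ask w v) : S.G.Adj v w := h.earlier.1.symm

/-- The asker holds no pebble, and in a cheapest flow all sources of moves into it are earlier
neighbors. So both pebbles come from `v`, at the price of four. -/
theorem Ask.four_le (h : S.Ask w v) : 4 ≤ S.r v ∧ S.τ 4 v < S.τ 2 w := by
  obtain ⟨f, Q, hf⟩ := exists_isMinFlow (G := S.G) (P := S.P) (k := 2) (v := w) h.1.2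
  have hP := h.1.P_eq_zero
  have := hf.of_sole_source (q := v) (by omega)
    fun u hu => (h.2 u).mp ⟨(hf.adj hu).symm, hf.source hu⟩
  rw [hP] at this
  exact this

/-- A unit bringing two pebbles to `v` would reach the asker, which no unit reaches. -/
theorem Ask.ri_le_one (h : S.Ask w v) (i : ι) : S.ri i v ≤ 1 := by
  have h1 := ri_div_two_le (i := i) h.adj
  rw [ri_eq_zero h.1.1 i] at h1
  omega

theorem Ask.s_eq_c (h : S.Ask w v) : S.s v = S.c v := UnitSystem.s_eq_c h.ri_le_one

theorem exists_ask (h : S.asks v ≠ 0) : ∃ w, S.Ask w v := by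
  obtain ⟨w, hw⟩ := Finset.card_ne_zero.mp h
  exact ⟨w, by simpa using hw⟩

theorem asks_eq_zero (h : ∀ w, ¬ S.Ask w v) : S.asks v = 0 := by
  by_contra h0
  obtain ⟨w, hw⟩ := exists_ask h0
  exact h w hw

theorem asks_eq_zero_of_two_le (h : 2 ≤ S.ri i v) : S.asks v = 0 :=
  asks_eq_zero fun w hw => by
    have := hw.ri_le_one i
    omega

/-- Neighbors that do not ask reduce the support given. -/
theorem asks_add_card_le (s : Finset V) (hs : ∀ u ∈ s, S.G.Adj v u ∧ ¬ S.Ask u v) :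
    S.asks v + #s ≤ S.d + 2 := by
  classical
  unfold asks
  rw [← Finset.card_union_of_disjoint]
  · refine (Finset.card_le_card fun u hu => ?_).trans (S.card_le v)
    simp only [Finset.mem_union, Finset.mem_filter, Finset.mem_univ, true_and] at hu ⊢
    rcases hu with hu | hu
    · exact hu.adj
    · exact (hs u hu).1
  · rw [Finset.disjoint_left]
    intro u hu hu'
    exact (hs u hu').2 (by simpa using hu)

/-- An asked vertex holds at most one pebble, so its second one enters from some `w` that can have
two pebbles earlier. An asker can have two only later than `v` can have four; hence `w` does not
ask. -/
theorem asks_le (S : UnitSystem V ι) (v : V) : S.asks v ≤ S.d + 1 := by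
  by_cases h0 : S.asks v = 0
  · omega
  · obtain ⟨u, hu⟩ := exists_ask h0
    have h4 := hu.four_le.1
    obtain ⟨f, Q, hf⟩ := exists_isMinFlow (G := S.G) (P := S.P) (k := 2) (v := v)
      ((by norm_num : 2 ≤ 4).trans h4)
    have hP := P_le_one hu.ri_le_one
    obtain ⟨w, hw⟩ := hf.exists_into (by omega)
    have := asks_add_card_le (S := S) (v := v) {w} (by
      intro a ha
      rw [Finset.mem_singleton] at ha
      subst ha
      refine ⟨(hf.adj hw).symm, fun hask => ?_⟩
      have h1 := (hf.source hw).2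
      have h2 := hask.four_le.2
      have h3 : S.τ 2 v ≤ S.τ 4 v := cost_mono (by norm_num) h4
      unfold τ at h2 h3
      omega)
    simpa using this

/-! ### Shares of the edges -/

theorem IsX.not_isZ (h : S.IsX v) : ¬ S.IsZ v := fun h' => by
  have := h.1
  have := h'.1
  omega

theorem IsC.not_isZ (h : S.IsC v) : ¬ S.IsZ v := fun h' => by
  have := h'.1
  unfold IsC at h
  omega

theorem IsC.not_isX (h : S.IsC v) : ¬ S.IsX v := fun h' => by
  have := h'.1
  unfold IsC at h
  omega

theorem IsC.not_isE (h : S.IsC v) : ¬ S.IsE v := fun h' => by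
  have := h'.1
  unfold IsC at h
  omega

theorem IsX.not_isE (h : S.IsX v) : ¬ S.IsE v := fun h' => by
  have := h.2
  have := h'.2
  omega

theorem IsE.not_isZ (h : S.IsE v) : ¬ S.IsZ v := fun h' => by
  have := h.1
  have := h'.1
  omega

theorem IsZ.not_isE (h : S.IsZ v) : ¬ S.IsE v := fun h' => h'.not_isZ h

theorem not_ask (h : ¬ S.IsZ w) : ¬ S.Ask w v := fun h' => h h'.1

theorem Earlier.not_earlier (h : S.Earlier v w) : ¬ S.Earlier w v :=
  fun h' => h.2.2.not_gt h'.2.2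

open Classical in
theorem IsZ.ψ_eq (h : S.IsZ v) (w : V) : S.ψ v w =
    if S.Earlier v w then (if S.Ask v w then 3 else 2) else if S.Ask w v then -1 else 0 := by
  unfold ψ
  rw [if_pos h]

theorem IsX.ψ_of_isE (h : S.IsX v) (hw : S.IsE w) : S.ψ v w = 1 := by
  unfold ψ
  rw [if_neg h.not_isZ, if_pos h, if_pos hw]

open Classical in
theorem IsX.ψ_of_isZ (h : S.IsX v) (hw : S.IsZ w) :
    S.ψ v w = if S.Ask w v then -1 else if S.τ 2 w < S.τ 2 v then 2 else 0 := by
  unfold ψ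
  rw [if_neg h.not_isZ, if_pos h, if_neg hw.not_isE, if_pos hw]

open Classical in
theorem IsX.ψ_of_isX (h : S.IsX v) (hw : S.IsX w) : S.ψ v w =
    if S.par v = w then 2 else if S.par w = v then 0 else if S.Share v w then 1
      else if S.τ 2 w < S.τ 2 v then 2 else 0 := by
  unfold ψ
  rw [if_neg h.not_isZ, if_pos h, if_neg hw.not_isE, if_neg hw.not_isZ, if_pos hw]

open Classical in
theorem IsX.ψ_of_isC (h : S.IsX v) (hw : S.IsC w) :
    S.ψ v w = if S.Wants w ∧ S.par w = v then 1 else 2 := by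
  unfold ψ
  rw [if_neg h.not_isZ, if_pos h, if_neg hw.not_isE, if_neg hw.not_isZ, if_neg hw.not_isX,
    if_pos hw]

theorem IsC.ψ_of_isE (h : S.IsC v) (hw : S.IsE w) : S.ψ v w = 1 := by
  unfold ψ
  rw [if_neg h.not_isZ, if_neg h.not_isX, if_pos h, if_pos (Or.inl hw)]

theorem IsC.ψ_of_isC (h : S.IsC v) (hw : S.IsC w) : S.ψ v w = 1 := by
  unfold ψ
  rw [if_neg h.not_isZ, if_neg h.not_isX, if_pos h, if_pos (Or.inr hw)]

open Classical in
theorem IsC.ψ_of_isZ (h : S.IsC v) (hw : S.IsZ w) : S.ψ v w = if S.Ask w v then -1 else 0 := by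
  unfold ψ
  rw [if_neg h.not_isZ, if_neg h.not_isX, if_pos h,
    if_neg (not_or.mpr ⟨hw.not_isE, fun h' => h'.not_isZ hw⟩), if_pos hw]

open Classical in
theorem IsC.ψ_of_isX (h : S.IsC v) (hw : S.IsX w) :
    S.ψ v w = if S.Wants v ∧ S.par v = w then 1 else 0 := by
  unfold ψ
  rw [if_neg h.not_isZ, if_neg h.not_isX, if_pos h,
    if_neg (not_or.mpr ⟨hw.not_isE, fun h' => h'.not_isX hw⟩), if_neg hw.not_isZ, if_pos hw]

theorem IsL.ψ_le (h : S.IsL w) (v : V) : S.ψ v w ≤ 0 := by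
  have h1 : ¬ S.IsZ w := fun h' => by have := h.2; have := h'.2; omega
  have h2 : ¬ S.IsE w := fun h' => by have := h.1; have := h'.1; omega
  have h3 : ¬ S.IsX w := fun h' => by have := h.1; have := h'.1; omega
  have h4 : ¬ S.IsC w := fun h' => by have := h.1; unfold IsC at h'; omega
  have h5 : ¬ S.Earlier v w := fun h' => by have := h.2; have := h'.2.1; omega
  unfold ψ
  simp only [h1, h2, h3, h4, h5, not_ask h1, if_false, or_self]
  split_ifs <;> norm_num

theorem IsE.ψ_le (h : S.IsE w) (hvw : S.G.Adj v w) : S.ψ v w ≤ 1 := by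
  rcases S.cases_c v with hv | hv | hv | hv | hv
  · rw [hv.ψ_of_isE h]
  · rw [hv.ψ_of_isE h]
  · unfold ψ
    rw [if_neg hv.not_isZ, if_neg fun h' : S.IsX v => h'.not_isE hv,
      if_neg fun h' : S.IsC v => h'.not_isE hv]
    norm_num
  · have h5 : ¬ S.Earlier v w := fun h' => by
      obtain ⟨j, hj, -, hs⟩ := exists_unit h.1
      have h1 := ri_div_two_le (i := j) hvw.symm
      rw [ri_eq_zero hv.1 j, ← hs, ← h.2] at h1
      have := h'.2.1
      omega
    rw [hv.ψ_eq, if_neg h5]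
    split_ifs <;> norm_num
  · unfold ψ
    have h1 : ¬ S.IsZ v := fun h' => by have := hv.2; have := h'.2; omega
    have h3 : ¬ S.IsX v := fun h' => by have := hv.1; have := h'.1; omega
    have h4 : ¬ S.IsC v := fun h' => by have := hv.1; unfold IsC at h'; omega
    rw [if_neg h1, if_neg h3, if_neg h4]
    norm_num

/-- The reach of a unit at least doubles on the way to the parent, and both steps would belong to
the only unit that reaches `v`. -/
theorem par_ne_of_par (hv : S.c v = 1) (hvw : v ≠ w) (h : S.par v = w) : S.par w ≠ v := by
  intro h'
  obtain ⟨j, hj, -, -, hpj⟩ := par_isPred hv (by rw [h]; exact hvw.symm)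
  have h1 := hpj.2.2.2.1
  rw [h] at h1
  rcases S.par_spec w with ⟨k, hpk⟩ | ⟨hw, -⟩
  · have h2 := hpk.2.2.2.1
    rw [h'] at h2
    have h3 := hpk.1
    have : k = j := unit_unique hv hj (by omega)
    subst this
    omega
  · exact hvw (h'.symm.trans hw)

theorem ψ_add_ψ_le_of_isZ_isZ (hv : S.IsZ v) (hw : S.IsZ w) : S.ψ v w + S.ψ w v ≤ 2 := by
  rw [hv.ψ_eq, hw.ψ_eq]
  by_cases h1 : S.Earlier v w
  · rw [if_pos h1, if_neg h1.not_earlier]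
    split_ifs <;> norm_num
  · rw [if_neg h1, if_neg fun h : S.Ask v w => h1 h.earlier]
    split_ifs <;> norm_num

theorem ψ_add_ψ_le_of_isX_isZ (hv : S.IsX v) (hw : S.IsZ w) : S.ψ v w + S.ψ w v ≤ 2 := by
  rw [hv.ψ_of_isZ hw, hw.ψ_eq, if_neg (not_ask hv.not_isZ)]
  by_cases h1 : S.Earlier w v
  · rw [if_pos h1, if_neg h1.2.2.not_gt]
    split_ifs <;> norm_num
  · rw [if_neg h1]
    split_ifs <;> norm_num

theorem ψ_add_ψ_le_of_isC_isZ (hv : S.IsC v) (hw : S.IsZ w) : S.ψ v w + S.ψ w v ≤ 2 := by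
  rw [hv.ψ_of_isZ hw, hw.ψ_eq, if_neg (not_ask hv.not_isZ)]
  split_ifs <;> norm_num

theorem ψ_add_ψ_le_of_isX_isC (hv : S.IsX v) (hw : S.IsC w) : S.ψ v w + S.ψ w v ≤ 2 := by
  rw [hv.ψ_of_isC hw, hw.ψ_of_isX hv]
  split_ifs <;> norm_num

theorem share_comm : S.Share v w ↔ S.Share w v :=
  exists_congr fun _ => and_comm

theorem ψ_add_ψ_le_of_isX_isX (hvw : v ≠ w) (hv : S.IsX v) (hw : S.IsX w) :
    S.ψ v w + S.ψ w v ≤ 2 := by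
  rw [hv.ψ_of_isX hw, hw.ψ_of_isX hv]
  by_cases h1 : S.par v = w
  · rw [if_pos h1, if_neg (par_ne_of_par hv.1 hvw h1), if_pos h1]
    norm_num
  · by_cases h2 : S.par w = v
    · rw [if_neg h1, if_pos h2, if_pos h2]
      norm_num
    · rw [if_neg h1, if_neg h2, if_neg h2, if_neg h1]
      by_cases h3 : S.Share v w
      · rw [if_pos h3, if_pos (share_comm.mp h3)]
        norm_num
      · rw [if_neg h3, if_neg fun h => h3 (share_comm.mp h)]
        split_ifs <;> omega

/-- A vertex with spare charge. -/
def IsH (S : UnitSystem V ι) (v : V) : Prop := S.IsC v ∨ S.IsX v ∨ S.IsZ v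

theorem ψ_add_ψ_le (hvw : v ≠ w) (hv : S.IsH v) (hw : S.IsH w) : S.ψ v w + S.ψ w v ≤ 2 := by
  rcases hv with hv | hv | hv <;> rcases hw with hw | hw | hw
  · rw [hv.ψ_of_isC hw, hw.ψ_of_isC hv]
    norm_num
  · rw [add_comm]
    exact ψ_add_ψ_le_of_isX_isC hw hv
  · exact ψ_add_ψ_le_of_isC_isZ hv hw
  · exact ψ_add_ψ_le_of_isX_isC hv hw
  · exact ψ_add_ψ_le_of_isX_isX hvw hv hw
  · exact ψ_add_ψ_le_of_isX_isZ hv hw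
  · rw [add_comm]
    exact ψ_add_ψ_le_of_isC_isZ hw hv
  · rw [add_comm]
    exact ψ_add_ψ_le_of_isX_isZ hw hv
  · exact ψ_add_ψ_le_of_isZ_isZ hv hw

theorem ite_nonneg {p : Prop} {_ : Decidable p} {a b : ℤ} (ha : 0 ≤ a) (hb : 0 ≤ b) :
    0 ≤ if p then a else b := by
  split_ifs <;> assumption

theorem φ_nonneg (S : UnitSystem V ι) (v w : V) : 0 ≤ S.φ v w := by
  unfold φ
  by_cases h : S.Ask w v
  · have hle : -1 ≤ S.ψ v w := by
      unfold ψ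
      split_ifs <;> norm_num
    rw [if_pos h]
    linarith
  · rw [if_neg h, add_zero]
    unfold ψ
    rw [if_neg h, if_neg h]
    repeat' apply ite_nonneg
    all_goals norm_num

theorem φ_eq (h : ¬ S.Ask w v) : S.φ v w = S.ψ v w := by
  unfold φ
  rw [if_neg h, add_zero]

open Classical in
theorem sum_ψ (S : UnitSystem V ι) (v : V) :
    ∑ w with S.G.Adj v w, S.ψ v w = ∑ w with S.G.Adj v w, S.φ v w - S.asks v := by
  have h : (∑ w with S.G.Adj v w, if S.Ask w v then (1 : ℤ) else 0) = S.asks v := by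
    rw [Finset.sum_ite, Finset.sum_const_zero, add_zero, Finset.sum_const, nsmul_one,
      Finset.filter_filter]
    unfold asks
    congr 2
    ext w
    simp only [Finset.mem_filter, Finset.mem_univ, true_and]
    exact ⟨fun h => h.2, fun h => ⟨h.adj, h⟩⟩
  rw [← h, ← Finset.sum_sub_distrib]
  refine Finset.sum_congr rfl fun w _ => ?_
  unfold φ
  ring

open Classical in
theorem sum_φ_ge (hvw : S.G.Adj v w) : S.φ v w ≤ ∑ w with S.G.Adj v w, S.φ v w :=
  Finset.single_le_sum (f := fun w => S.φ v w) (fun w _ => S.φ_nonneg v w)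
    (by simpa using hvw)

/-! ### Charges in `IsZ` and `IsC` -/

/-- The charge of a vertex in `IsH` before the edges are shared. -/
noncomputable def base (S : UnitSystem V ι) (v : V) : ℤ :=
  S.d * ((S.r v : ℤ) - S.s v + S.c v - 2) + S.c v - 3

/-- At most `d + 1 ≤ 2 * d` neighbors ask, as `1 ≤ d`. -/
theorem asks_le_mul {k : ℤ} (h : S.asks v ≠ 0 → 2 ≤ k) (hk : 0 ≤ k) : (S.asks v : ℤ) ≤ S.d * k := by
  by_cases h0 : S.asks v = 0
  · rw [h0]
    positivity
  · have h1 : (S.asks v : ℤ) ≤ S.d + 1 := by exact_mod_cast S.asks_le v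
    have h2 : (1 : ℤ) ≤ S.d := by exact_mod_cast S.one_le_d
    nlinarith [h h0]

-- The deficit is at most 3. Two earlier neighbors yield 4 and a single one, being asked, yields 3.
-- An asked vertex has reach at least 4, which pays for the support it gives.
open Classical in
theorem IsZ.base_add_sum_nonneg (h : S.IsZ v) :
    0 ≤ S.base v + ∑ w with S.G.Adj v w, S.ψ v w := by
  have hr : (2 : ℤ) ≤ S.r v := by exact_mod_cast h.2
  have h3 : (3 : ℤ) ≤ ∑ w with S.G.Adj v w, S.φ v w := by
    obtain ⟨w, hw⟩ := h.exists_earlier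
    by_cases hex : ∃ u, S.Earlier v u ∧ u ≠ w
    · obtain ⟨u, hu, huw⟩ := hex
      have h2 : ∀ x, S.Earlier v x → 2 ≤ S.φ v x := fun x hx => by
        rw [φ_eq fun h' => hx.not_earlier h'.earlier, h.ψ_eq, if_pos hx]
        split_ifs <;> norm_num
      have hle : ∑ x ∈ ({u, w} : Finset V), S.φ v x ≤ ∑ w with S.G.Adj v w, S.φ v w := by
        refine Finset.sum_le_sum_of_subset_of_nonneg (fun x hx => ?_) fun x _ _ => S.φ_nonneg v x
        simp only [Finset.mem_insert, Finset.mem_singleton] at hx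
        rcases hx with rfl | rfl
        · simpa using hu.1
        · simpa using hw.1
      rw [Finset.sum_pair huw] at hle
      linarith [h2 u hu, h2 w hw]
    · push Not at hex
      have hask : S.Ask v w := ⟨h, fun u => ⟨fun hu => hex u hu, fun hu => hu ▸ hw⟩⟩
      refine le_trans (le_of_eq ?_) (sum_φ_ge hw.1)
      rw [φ_eq fun h' => hw.not_earlier h'.earlier, h.ψ_eq, if_pos hw, if_pos hask]
  have hasks : (S.asks v : ℤ) ≤ S.d * (S.r v - 2) := by
    refine asks_le_mul (fun h0 => ?_) (by linarith)
    obtain ⟨u, hu⟩ := exists_ask h0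
    have : (4 : ℤ) ≤ S.r v := by exact_mod_cast hu.four_le.1
    linarith
  rw [sum_ψ]
  unfold base
  rw [s_eq_zero h.1, h.1]
  push_cast
  linarith

open Classical in
theorem IsC.one_le_sum_φ (h : S.IsC v) (hw : S.Wants v) :
    1 ≤ ∑ w with S.G.Adj v w, S.φ v w := by
  obtain ⟨j, hj⟩ := h.par_isPred
  have hc := hj.one_le_c
  refine le_trans (le_of_eq ?_) (sum_φ_ge hj.2.2.1)
  have hz : ¬ S.IsZ (S.par v) := fun h' => by
    have := h'.1
    omega
  rw [φ_eq (not_ask hz)]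
  rcases S.cases_c (S.par v) with hp | hp | hp | hp | hp
  · rw [h.ψ_of_isC hp]
  · rw [h.ψ_of_isX hp, if_pos ⟨hw, rfl⟩]
  · rw [h.ψ_of_isE hp]
  · exact absurd hp hz
  · have := hp.1
    omega

-- Only `c v = 2` leaves a deficit, of 1. `Wants` holds exactly when `d * (r - s)` does not cover
-- this unit and the support given; then the edge to the parent supplies the unit.
open Classical in
theorem IsC.base_add_sum_nonneg (h : S.IsC v) :
    0 ≤ S.base v + ∑ w with S.G.Adj v w, S.ψ v w := by
  have hc : (2 : ℤ) ≤ S.c v := by exact_mod_cast h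
  have hs : (S.s v : ℤ) ≤ S.r v := by exact_mod_cast S.s_le_r v
  have hφ : 0 ≤ ∑ w with S.G.Adj v w, S.φ v w := Finset.sum_nonneg fun w _ => S.φ_nonneg v w
  have hasks : (S.asks v : ℤ) ≤ S.d * ((S.r v : ℤ) - S.s v + S.c v - 2) := by
    refine asks_le_mul (fun h0 => ?_) (by linarith)
    obtain ⟨u, hu⟩ := exists_ask h0
    have h1 : (4 : ℤ) ≤ S.r v := by exact_mod_cast hu.four_le.1
    have h2 : (S.s v : ℤ) = S.c v := by exact_mod_cast hu.s_eq_c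
    linarith
  rw [sum_ψ]
  unfold base
  rcases hc.eq_or_lt with hc2 | hc3
  · by_cases hw : S.Wants v
    · have := h.one_le_sum_φ hw
      linarith
    · have hnot : ¬ (S.d * (S.r v - S.s v) < 1 + S.asks v) := fun h' =>
        hw ⟨by exact_mod_cast hc2.symm, h'⟩
      have h' : (1 : ℤ) + S.asks v ≤ S.d * ((S.r v : ℤ) - S.s v) := by
        have := not_lt.mp hnot
        rw [← Nat.cast_sub (S.s_le_r v)]
        exact_mod_cast this
      rw [← hc2]
      have e : (S.r v : ℤ) - S.s v + 2 - 2 = S.r v - S.s v := by ring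
      rw [e]
      linarith
  · linarith

/-! ### Trees in `IsX` -/

variable {t : V}

open Classical in
/-- The parent of `v` within `IsX`, or `v` if there is none. -/
noncomputable def parX (S : UnitSystem V ι) (v : V) : V := if S.IsX (S.par v) then S.par v else v

/-- The last vertex in `IsX` on the way from `v` to the unit that reaches it. -/
noncomputable def root (S : UnitSystem V ι) (v : V) : V := S.parX^[∑ w, S.r w] v

theorem IsX.parX (h : S.IsX v) : S.IsX (S.parX v) := by
  unfold UnitSystem.parX
  split_ifs with h'
  · exact h'
  · exact h

theorem IsX.one_le_s (h : S.IsX v) : 1 ≤ S.s v := by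
  have h1 := S.c_le_s v
  have h2 := h.1
  omega

theorem IsX.parX_eq_or (h : S.IsX v) : S.parX v = v ∨ 2 * S.s v ≤ S.s (S.parX v) := by
  unfold UnitSystem.parX
  split_ifs with h'
  · by_cases hp : S.par v = v
    · exact Or.inl hp
    · obtain ⟨j, hj, hs, -, hpr⟩ := par_isPred h.1 hp
      have h1 := hpr.2.2.2.1
      right
      rw [hs, s_eq_ri h'.1 (j := j) (by omega)]
      exact h1
  · exact Or.inl rfl

/-- Each step that moves at least doubles `s`, which is bounded by `∑ w, S.r w`. So the number of
iterations in `root` is large enough to stabilize. -/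
theorem IsX.parX_iterate (h : S.IsX v) (n : ℕ) : S.IsX (S.parX^[n] v) ∧
    (S.parX (S.parX^[n] v) = S.parX^[n] v ∨ n < S.s (S.parX^[n] v)) := by
  induction n with
  | zero => exact ⟨h, Or.inr h.one_le_s⟩
  | succ n ih =>
    rw [Function.iterate_succ_apply']
    refine ⟨ih.1.parX, ?_⟩
    rcases ih.2 with h1 | h1
    · left
      rw [h1, h1]
    · rcases ih.1.parX_eq_or with h2 | h2
      · left
        rw [h2, h2]
      · right
        omega

theorem IsX.root (h : S.IsX v) : S.IsX (S.root v) := (h.parX_iterate _).1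

theorem IsX.parX_root (h : S.IsX v) : S.parX (S.root v) = S.root v := by
  rcases (h.parX_iterate (∑ w, S.r w)).2 with h1 | h1
  · exact h1
  · exfalso
    have h2 := S.s_le_r (S.parX^[∑ w, S.r w] v)
    have h3 := Finset.single_le_sum (f := S.r) (fun _ _ => Nat.zero_le _)
      (Finset.mem_univ (S.parX^[∑ w, S.r w] v))
    omega

theorem IsX.root_parX (h : S.IsX v) : S.root (S.parX v) = S.root v := by
  have h1 := h.parX_root
  unfold UnitSystem.root at h1 ⊢
  rw [← Function.iterate_succ_apply, Function.iterate_succ_apply', h1]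

theorem root_of_parX (h : S.parX v = v) : S.root v = v := Function.iterate_fixed h _

theorem IsX.root_par (h : S.IsX v) (hp : S.IsX (S.par v)) : S.root (S.par v) = S.root v := by
  have h1 := h.root_parX
  unfold UnitSystem.parX at h1
  rwa [if_pos hp] at h1

theorem par_of_root_ne (h : S.root v ≠ v) : S.IsX (S.par v) ∧ S.par v ≠ v := by
  by_contra hcon
  refine h (root_of_parX ?_)
  unfold parX
  split_ifs with h'
  · by_contra h2
    exact hcon ⟨h', h2⟩
  · rfl

theorem par_eq_or_of_parX (h : S.parX t = t) : S.par t = t ∨ ¬ S.IsX (S.par t) := by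
  unfold parX at h
  split_ifs at h with h'
  · exact Or.inl h
  · exact Or.inr h'

/-- Only `j` reaches `v`, and `j` misses `w`. So neither is the parent of the other and they share
no unit, which leaves the decision to the order in time. -/
theorem IsX.φ_eq_two_of_far (hv : S.IsX v) (hj : 1 ≤ S.ri j v) (h0 : S.ri j w = 0)
    (hτ : S.τ 2 w < S.τ 2 v) (hw : S.IsX w ∨ S.IsZ w) : S.φ v w = 2 := by
  rcases hw with hw | hw
  · have h1 : S.par v ≠ w := by
      intro h
      rcases S.par_spec v with ⟨k, hk⟩ | ⟨hk, -⟩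
      · have h2 := hk.2.2.2.1
        have h3 := hk.1
        rw [h, unit_unique hv.1 hj h3, h0] at h2
        rw [unit_unique hv.1 hj h3] at h3
        omega
      · rw [← h, hk] at h0
        omega
    have h2 : S.par w ≠ v := by
      intro h
      rcases S.par_spec w with ⟨k, hk⟩ | ⟨hk, -⟩
      · have h2 := hk.2.2.2.1
        have h3 := hk.1
        rw [h] at h2
        rw [unit_unique hv.1 hj (i := k) (by omega), h0] at h3
        omega
      · rw [← h, hk] at hj
        omega
    have h3 : ¬ S.Share v w := by
      rintro ⟨k, hk, hk'⟩
      rw [unit_unique hv.1 hj hk, h0] at hk'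
      omega
    rw [φ_eq (not_ask hw.not_isZ), hv.ψ_of_isX hw, if_neg h1, if_neg h2, if_neg h3, if_pos hτ]
  · have h1 : ¬ S.Ask w v := by
      intro hask
      have h2 := hask.four_le
      have h3 : S.τ 2 v ≤ S.τ 4 v := cost_mono (by norm_num) h2.1
      omega
    rw [φ_eq h1, hv.ψ_of_isZ hw, if_neg h1, if_pos hτ]

theorem IsX.not_isE_of_far (hv : S.IsX v) (hvw : S.G.Adj v w) (hj : 1 ≤ S.ri j v)
    (h0 : S.ri j w = 0) (hr : 2 ≤ S.r w) : ¬ S.IsE w := by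
  intro hw
  obtain ⟨i, hi, -, hs⟩ := exists_unit hw.1
  have h1 := ri_div_two_le (i := i) hvw.symm
  rw [← hs, ← hw.2] at h1
  rw [unit_unique hv.1 hj (i := i) (by omega), h0] at hi
  omega

theorem IsX.one_le_φ_of_isC (hv : S.IsX v) (hw : S.IsC w) : 1 ≤ S.φ v w := by
  rw [φ_eq (not_ask hw.not_isZ), hv.ψ_of_isC hw]
  split_ifs <;> norm_num

theorem IsX.φ_of_isE (hv : S.IsX v) (hw : S.IsE w) : S.φ v w = 1 := by
  rw [φ_eq (not_ask hw.not_isZ), hv.ψ_of_isE hw]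

/-- In a cheapest way to overfill some vertex of the tree of `t`, some pebble enters the tree
otherwise than from the parent. -/
theorem exists_into_tree {y : V} (hy : S.IsX y) (hyt : S.root y = t)
    (hlack : S.par t = t ∨ S.IsE (S.par t))
    (hmin : ∀ v, S.IsX v → S.root v = t → S.τ (S.s y + 1) y ≤ S.τ (S.s v + 1) v)
    {f : V → V → ℕ} {Q : Distribution V} (hf : IsMinFlow S.G S.P (S.s y + 1) y f Q) :
    ∃ w, 1 ≤ f w y ∧ w ≠ S.par y := by
  by_contra hcon
  push Not at hcon
  obtain ⟨j, hj, hs, hcase⟩ := cases_par hy.1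
  rcases hcase with ⟨-, hp, hP⟩ | ⟨hp, hP, hpr⟩
  · obtain ⟨w, hw⟩ := hf.exists_into (by omega)
    have := hcon w hw
    rw [hp] at this
    exact (hf.adj hw).ne this
  · have h1 := hf.of_sole_source (q := S.par y) (by omega) hcon
    rw [hP, Nat.sub_zero] at h1
    have hle := ri_div_two_le (i := j) hpr.2.2.1.symm
    have hcov := hpr.2.2.2.1
    -- By halving, `j` brings at most `2 * s y + 1` pebbles to the parent, so the amount demanded
    -- from the parent overfills it.
    have hs' : S.c (S.par y) = 1 → S.s (S.par y) + 1 ≤ 2 * (S.s y + 1) := fun hc => by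
      rw [s_eq_ri hc (j := j) (by omega)]
      omega
    have hE : ¬ S.IsE (S.par y) := fun hE => by
      have h2 := hs' hE.1
      have h3 := hE.2
      have h4 : 2 * (S.s y + 1) ≤ S.r (S.par y) := h1.1
      omega
    have hX : S.IsX (S.par y) := by
      by_cases hne : S.root y = y
      · rw [← hyt, hne] at hlack
        rcases hlack with h | h
        · exact absurd h hp
        · exact absurd h hE
      · exact (par_of_root_ne hne).1
    have h2 := hmin _ hX ((hy.root_par hX).trans hyt)
    have h3 : S.τ (S.s (S.par y) + 1) (S.par y) ≤ S.τ (2 * (S.s y + 1)) (S.par y) :=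
      cost_mono (hs' hX.1) h1.1
    have h4 : S.τ (2 * (S.s y + 1)) (S.par y) < S.τ (S.s y + 1) y := h1.2
    omega

/-- Take the vertex `y` of the tree that is cheapest to overfill and trace a cheapest flow
backwards. If the source of a move is a child in the tree, it holds no pebbles of its own, so it is
fed too, and not by its parent, since opposite moves do not occur. As `s` at least halves, the trace
ends, at an edge with positive `φ`. -/
theorem exists_extra_edge (ht : S.IsX t) (hroot : S.root t = t)
    (hlack : S.par t = t ∨ S.IsE (S.par t)) :
    ∃ v w, S.IsX v ∧ S.root v = t ∧ S.G.Adj v w ∧ w ≠ S.par v ∧ 1 ≤ S.φ v w := by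
  classical
  obtain ⟨y, hy, hmin⟩ := Finset.exists_min_image ({v | S.IsX v ∧ S.root v = t} : Finset V)
    (fun v => S.τ (S.s v + 1) v) ⟨t, by simpa using ⟨ht, hroot⟩⟩
  simp only [Finset.mem_filter, Finset.mem_univ, true_and, and_imp] at hy hmin
  obtain ⟨f, Q, hf⟩ := exists_isMinFlow (G := S.G) (P := S.P) (k := S.s y + 1) (v := y) hy.1.2
  obtain ⟨w₀, hw₀, hne₀⟩ := exists_into_tree hy.1 hy.2 hlack hmin hf
  suffices H : ∀ n v w, S.s v = n → S.IsX v → S.root v = t → 1 ≤ f w v → w ≠ S.par v →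
      ∃ v w, S.IsX v ∧ S.root v = t ∧ S.G.Adj v w ∧ w ≠ S.par v ∧ 1 ≤ S.φ v w from
    H _ y w₀ rfl hy.1 hy.2 hw₀ hne₀
  intro n
  induction n using Nat.strong_induction_on with
  | _ n ih =>
  intro v w hn hv hvt hw hne
  have hadj := (hf.adj hw).symm
  obtain ⟨hr, hτ⟩ := hf.source hw
  have hr : 2 ≤ S.r w := hr
  have hτ : S.τ 2 w < S.τ (S.s y + 1) y := hτ
  have hyv := hmin v hv hvt
  obtain ⟨j, hj, -, hs⟩ := exists_unit hv.1
  -- If `j` misses `w`, it brings only one pebble to `v`. Overfilling `v` then means two pebbles,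
  -- and the choice of `y` compares the costs.
  have hfar : S.ri j w = 0 → S.τ 2 w < S.τ 2 v := by
    intro h0
    have h1 := ri_div_two_le (i := j) hadj
    have h2 : S.s v = 1 := by omega
    rw [h2] at hyv
    exact hτ.trans_le hyv
  rcases S.cases_c w with hwc | hwc | hwc | hwc | hwc
  · exact ⟨v, w, hv, hvt, hadj, hne, hv.one_le_φ_of_isC hwc⟩
  · by_cases hpw : S.par w = v
    · obtain ⟨k, hk, hks, hP, hpr⟩ := par_isPred hwc.1 (by rw [hpw]; exact hadj.ne)
      obtain ⟨u, hu⟩ := hf.exists_into_of_out hw hP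
      have h1 := hpr.2.2.2.1
      rw [hpw] at h1
      have h2 : S.s v = S.ri k v := s_eq_ri hv.1 (by omega)
      refine ih (S.s w) (by omega) w u rfl hwc ?_ hu ?_
      · rw [← hvt, ← hpw]
        exact (hwc.root_par (by rw [hpw]; exact hv)).symm
      · rw [hpw]
        rintro rfl
        have := hf.not_opposite hw
        omega
    · by_cases hsh : S.Share v w
      · refine ⟨v, w, hv, hvt, hadj, hne, ?_⟩
        rw [φ_eq (not_ask hwc.not_isZ), hv.ψ_of_isX hwc, if_neg hne.symm, if_neg hpw, if_pos hsh]
      · have h0 : S.ri j w = 0 := by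
          by_contra h0
          exact hsh ⟨j, hj, by omega⟩
        refine ⟨v, w, hv, hvt, hadj, hne, ?_⟩
        rw [hv.φ_eq_two_of_far hj h0 (hfar h0) (Or.inl hwc)]
        norm_num
  · exact ⟨v, w, hv, hvt, hadj, hne, (hv.φ_of_isE hwc).ge⟩
  · have h0 := ri_eq_zero hwc.1 j
    refine ⟨v, w, hv, hvt, hadj, hne, ?_⟩
    rw [hv.φ_eq_two_of_far hj h0 (hfar h0) (Or.inr hwc)]
    norm_num
  · have := hwc.2
    omega

/-- The second pebble comes from a neighbor which the single pebble of the unit cannot reach. -/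
theorem exists_edge_of_single (ht : S.IsX t) (hp : S.par t = t) (hs : S.s t = 1) :
    ∃ w, S.G.Adj t w ∧ 2 ≤ S.φ t w := by
  obtain ⟨j, hj, hsj, hcase⟩ := cases_par ht.1
  rcases hcase with ⟨hhome, -, hP⟩ | ⟨hne, -⟩
  swap
  · exact absurd hp hne
  obtain ⟨f, Q, hf⟩ := exists_isMinFlow (G := S.G) (P := S.P) (k := 2) (v := t)
    (by have := ht.2; rw [hs] at this; exact this)
  obtain ⟨w, hw⟩ := hf.exists_into (by omega)
  have hadj := (hf.adj hw).symm
  obtain ⟨hr, hτ⟩ := hf.source hw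
  have h0 : S.ri j w = 0 := by
    by_contra h0
    obtain ⟨p, -, hp2, -⟩ := exists_pred (S.eq_zero j) (v := w) (by rw [← hhome]; exact hadj.ne')
      (Nat.one_le_iff_ne_zero.mpr h0)
    have h1 : 2 * S.ri j w ≤ S.ri j p := hp2
    have h2 := S.ri_le j p
    rw [← hhome] at h2
    omega
  refine ⟨w, hadj, ?_⟩
  rcases S.cases_c w with hwc | hwc | hwc | hwc | hwc
  · have h1 : ¬ (S.Wants w ∧ S.par w = t) := by
      rintro ⟨-, h1⟩
      obtain ⟨k, hk⟩ := hwc.par_isPred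
      have h2 := hk.1
      have h3 := hk.2.2.2.1
      rw [h1] at h3
      rw [unit_unique ht.1 hj (i := k) (by omega), h0] at h2
      omega
    rw [φ_eq (not_ask hwc.not_isZ), ht.ψ_of_isC hwc, if_neg h1]
  · exact (ht.φ_eq_two_of_far hj h0 hτ (Or.inl hwc)).ge
  · exact absurd hwc (ht.not_isE_of_far hadj hj h0 hr)
  · exact (ht.φ_eq_two_of_far hj h0 hτ (Or.inr hwc)).ge
  · have h1 : 2 ≤ S.r w := hr
    have := hwc.2
    omega

theorem IsX.bonus_nonneg (h : S.IsX v) : 0 ≤ S.bonus v := by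
  have h1 : (S.s v : ℤ) + 1 ≤ S.r v := by exact_mod_cast h.2
  have := asks_le_mul (S := S) (v := v) (k := S.r v - S.s v - 1) (fun h0 => by
    obtain ⟨w, hw⟩ := exists_ask h0
    have h2 : (4 : ℤ) ≤ S.r v := by exact_mod_cast hw.four_le.1
    have h3 : (S.s v : ℤ) = 1 := by
      rw [hw.s_eq_c, h.1]
      norm_num
    linarith) (by linarith)
  unfold bonus
  linarith

/-- If all neighbors of `v` other than `q` ask `v`, then four pebbles at `v` come through `q`. -/
theorem le_r_of_asks {q : V} (hq : S.G.Adj v q) (hq' : ¬ S.Ask q v) (h : S.asks v = S.d + 1)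
    (h4 : 4 ≤ S.r v) (hP : S.P v < 4) : 2 * (4 - S.P v) ≤ S.r q := by
  classical
  obtain ⟨f, Q, hf⟩ := exists_isMinFlow (G := S.G) (P := S.P) (k := 4) (v := v) h4
  refine (hf.of_sole_source hP fun u hu => ?_).1
  by_contra hne
  have hask : ¬ S.Ask u v := fun hask => by
    have h1 : S.τ 2 u < S.τ 4 v := (hf.source hu).2
    have h2 := hask.four_le.2
    omega
  have := asks_add_card_le (S := S) (v := v) {u, q} (by
    intro a ha
    simp only [Finset.mem_insert, Finset.mem_singleton] at ha
    rcases ha with rfl | rfl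
    · exact ⟨(hf.adj hu).symm, hask⟩
    · exact ⟨hq, hq'⟩)
  rw [Finset.card_pair hne] at this
  omega

theorem not_ask_of_one_le_c (h : 1 ≤ S.c w) : ¬ S.Ask w v :=
  not_ask fun h' => by
    have := h'.1
    omega

/-- If the bonus fails although some neighbor asks, then `d + 1` neighbors ask, that is, all but the
parent. So the four pebbles at `v` all come from the parent, which must have eight. -/
theorem one_le_bonus_or (hv : S.IsX v) (hp : S.par v ≠ v) (hD : S.s v + 2 ≤ S.r v) :
    1 ≤ S.bonus v ∨ 8 ≤ S.r (S.par v) ∧ S.s v = 1 := by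
  have hd := S.one_le_d
  by_cases h0 : S.asks v = 0
  · left
    unfold bonus
    have h1 : (S.s v : ℤ) + 2 ≤ S.r v := by exact_mod_cast hD
    have h2 : (1 : ℤ) ≤ S.d := by exact_mod_cast hd
    rw [h0]
    push_cast
    nlinarith
  · obtain ⟨w, hw⟩ := exists_ask h0
    have h4 := hw.four_le.1
    have hs1 : S.s v = 1 := hw.s_eq_c.trans hv.1
    have hle := S.asks_le v
    by_cases hb : 1 ≤ S.bonus v
    · exact Or.inl hb
    · right
      refine ⟨?_, hs1⟩
      obtain ⟨j, -, -, hP, hpr⟩ := par_isPred hv.1 hp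
      have hasks : S.asks v = S.d + 1 := by
        unfold bonus at hb
        rw [hs1] at hb
        have h1 : (4 : ℤ) ≤ S.r v := by exact_mod_cast h4
        have h2 : (1 : ℤ) ≤ S.d := by exact_mod_cast hd
        have h3 : (S.asks v : ℤ) ≤ S.d + 1 := by exact_mod_cast hle
        have h5 : (S.d : ℤ) + 1 ≤ S.asks v := by
          push_cast at hb
          nlinarith
        omega
      have := le_r_of_asks hpr.2.2.1 (not_ask_of_one_le_c hpr.one_le_c) hasks h4 (by omega)
      rw [hP] at this
      exact this

theorem two_le_bonus (h2 : 2 ≤ S.ri j t) (hD : S.s t + 3 ≤ S.r t) : 2 ≤ S.bonus t := by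
  unfold bonus
  rw [asks_eq_zero_of_two_le h2]
  have h1 : (S.s t : ℤ) + 3 ≤ S.r t := by exact_mod_cast hD
  have h2 : (1 : ℤ) ≤ S.d := by exact_mod_cast S.one_le_d
  push_cast
  nlinarith

/-- As above, all neighbors of `w` but `t` ask, so at least three of four pebbles at `w` cost six at
`t`. The unit `j` brings at most one pebble to `w`, hence at most three to `t`. -/
theorem two_le_bonus_of_wants (ht : S.IsX t) (hj : S.s t = S.ri j t) (h2 : 2 ≤ S.ri j t)
    (htw : S.G.Adj t w) (hw : S.Wants w) (hD : S.s w < S.r w) : 2 ≤ S.bonus t := by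
  have hd := S.one_le_d
  have hask0 : S.asks w ≠ 0 := by
    intro h0
    have h1 := hw.2
    have : 1 ≤ S.d * (S.r w - S.s w) := Nat.mul_pos hd (by omega)
    omega
  obtain ⟨u, hu⟩ := exists_ask hask0
  have hsw : S.s w = 2 := hu.s_eq_c.trans hw.1
  have h4 := hu.four_le.1
  have hle := S.asks_le w
  have hasks : S.asks w = S.d + 1 := by
    have h1 := hw.2
    have h3 : S.d * 2 ≤ S.d * (S.r w - S.s w) := Nat.mul_le_mul_left _ (by omega)
    omega
  have hP := P_le_one hu.ri_le_one
  have h6 := le_r_of_asks htw.symm (not_ask_of_one_le_c (by rw [ht.1])) hasks h4 (by omega)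
  have h7 := ri_div_two_le (i := j) htw
  have h8 := hu.ri_le_one j
  exact two_le_bonus h2 (by omega)

/-- The home keeps its own pebbles in the balance of a flow; subtracting them at the start and at
the end leaves a flow of the other units that brings in the surplus. -/
theorem exists_reach_erase (hj : S.IsX (S.home j)) (hs : S.s (S.home j) = S.ri j (S.home j)) :
    ∃ P' : Distribution V, S.P = S.U j + P' ∧ 1 ≤ reach S.G P' (S.home j) ∧
      P' (S.home j) = 0 := by
  classical
  have hsum : S.P = S.U j + ∑ i ∈ Finset.univ.erase j, S.U i :=
    (Finset.add_sum_erase Finset.univ S.U (Finset.mem_univ j)).symm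
  set P' : Distribution V := ∑ i ∈ Finset.univ.erase j, S.U i
  have hadd : ∀ w, S.P w = S.U j w + P' w := fun w => by rw [hsum]; rfl
  obtain ⟨f, Q, hf, hQ⟩ := exists_exec_reach S.G S.P (S.home j)
  have hP := S.P_home j
  have hU := S.ri_home j
  have hQ' : S.s (S.home j) + 1 ≤ Q (S.home j) := hj.2.trans_le hQ
  have hfl : IsFlow S.G f P' (fun w => Q w - S.U j w) := by
    refine ⟨hf.isFlow.adj, fun w => ?_⟩
    have h1 := hf.isFlow.bal w
    rw [hadd w] at h1
    by_cases hw : w = S.home j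
    · rw [hw] at h1 ⊢
      omega
    · rw [S.eq_zero j w hw] at h1 ⊢
      omega
  refine ⟨P', hsum, le_trans ?_ (hfl.le_reach _), ?_⟩
  · omega
  · have := hadd (S.home j)
    omega

/-- The other units alone reach `t`, through a neighbor `w` to which they can bring two pebbles on
top of those of `j`. If only `j` reaches `w`, then `w` is a child of `t` with surplus two; otherwise
`w` is in `IsC`. -/
theorem exists_gain_of_home (ht : S.IsX t) (hp : S.par t = t) (hs : 2 ≤ S.s t) :
    (∃ w, S.G.Adj t w ∧ 2 ≤ S.φ t w) ∨ 2 ≤ S.bonus t ∨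
      ∃ w, S.IsX w ∧ S.par w = t ∧ 1 ≤ S.bonus w := by
  obtain ⟨j, hj, hsj, hcase⟩ := cases_par ht.1
  rcases hcase with ⟨hhome, -, -⟩ | ⟨hne, -⟩
  swap
  · exact absurd hp hne
  obtain ⟨P', hPP, hr1, hP0⟩ := exists_reach_erase (S := S) (j := j) (hhome ▸ ht)
    (by rw [← hhome, hsj])
  rw [← hhome] at hr1 hP0
  obtain ⟨f, Q, hf⟩ := exists_isMinFlow hr1
  obtain ⟨w, hw⟩ := hf.exists_into (by omega)
  have hadj := (hf.adj hw).symm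
  have hr2 := (hf.source hw).1
  have hsup : S.ri j w + reach S.G P' w ≤ S.r w := by
    have := reach_add_le S.G (S.U j) P' w
    rw [← hPP] at this
    exact this
  have h1 := ri_div_two_le (i := j) hadj
  have hwj : w ≠ S.home j := by
    rw [← hhome]
    exact hadj.ne'
  have hjw : 1 ≤ S.ri j w := by omega
  have hcw := one_le_c hjw
  by_cases hc1 : S.c w = 1
  · have hsw := s_eq_ri hc1 hjw
    have hwX : S.IsX w := ⟨hc1, by omega⟩
    obtain ⟨k, -, -, hcase⟩ := cases_par hc1
    have hpw : S.par w ≠ w ∧ S.par w = t := by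
      rcases hcase with ⟨hk, -, -⟩ | ⟨hk, -, hpr⟩
      · exfalso
        refine hwj ?_
        rw [hk, unit_unique hc1 hjw (i := k) (by rw [hk]; exact S.one_le_ri_home k)]
      · refine ⟨hk, ?_⟩
        have hkj : k = j := unit_unique hc1 hjw hpr.1
        subst hkj
        rw [hhome]
        exact hpr.2.2.2.2 (hhome ▸ hadj.symm)
    rcases one_le_bonus_or hwX hpw.1 (by omega) with hb | ⟨hb, hb'⟩
    · exact Or.inr (Or.inr ⟨w, hwX, hpw.2, hb⟩)
    -- Since `j` brings one pebble to `w`, it brings at most three to `t`, far fewer than eight.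
    · rw [hpw.2] at hb
      exact Or.inr (Or.inl (two_le_bonus (j := j) (by omega) (by omega)))
  · have hwC : S.IsC w := by
      unfold IsC
      omega
    by_cases hwant : S.Wants w
    · right
      left
      obtain ⟨i, hij, hi, hsw⟩ := exists_two_units hwant.1 hjw
      have h3 := ri_div_two_le (i := i) hadj.symm
      have h4 : S.ri i t = 0 := by
        by_contra h0
        exact hij (unit_unique ht.1 hj (by omega))
      exact two_le_bonus_of_wants ht hsj (by omega) hadj hwant (by omega)
    · left
      refine ⟨w, hadj, ?_⟩
      rw [φ_eq (not_ask hwC.not_isZ), ht.ψ_of_isC hwC, if_neg fun h => hwant h.1]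

open Classical in
/-- The charge of `v` from edges not leading to its parent. -/
noncomputable def rest (S : UnitSystem V ι) (v : V) : ℤ :=
  ∑ w with S.G.Adj v w ∧ w ≠ S.par v, S.φ v w

theorem rest_nonneg (S : UnitSystem V ι) (v : V) : 0 ≤ S.rest v :=
  Finset.sum_nonneg fun w _ => S.φ_nonneg v w

theorem φ_le_rest (hvw : S.G.Adj v w) (hw : w ≠ S.par v) : S.φ v w ≤ S.rest v :=
  Finset.single_le_sum (f := fun w => S.φ v w) (fun w _ => S.φ_nonneg v w) (by simp [hvw, hw])

open Classical in
theorem rest_le_sum_φ (S : UnitSystem V ι) (v : V) :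
    S.rest v ≤ ∑ w with S.G.Adj v w, S.φ v w := by
  refine Finset.sum_le_sum_of_subset_of_nonneg (fun w hw => ?_) fun w _ _ => S.φ_nonneg v w
  simp only [Finset.mem_filter, Finset.mem_univ, true_and] at hw ⊢
  exact hw.1

open Classical in
theorem rest_add_le_sum_φ (hvp : S.G.Adj v (S.par v)) :
    S.rest v + S.φ v (S.par v) ≤ ∑ w with S.G.Adj v w, S.φ v w := by
  have h : ({w | S.G.Adj v w} : Finset V) =
      insert (S.par v) ({w | S.G.Adj v w ∧ w ≠ S.par v} : Finset V) := by
    ext w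
    simp only [Finset.mem_filter, Finset.mem_univ, true_and, Finset.mem_insert]
    by_cases hw : w = S.par v
    · simp [hw, hvp]
    · simp [hw]
  rw [h, Finset.sum_insert (by simp), add_comm, rest]

open Classical in
theorem IsX.base_add_sum_eq (h : S.IsX v) : S.base v + ∑ w with S.G.Adj v w, S.ψ v w =
    S.bonus v - 2 + ∑ w with S.G.Adj v w, S.φ v w := by
  rw [sum_ψ]
  unfold base bonus
  rw [h.1]
  push_cast
  ring

theorem IsX.φ_par_of_isX (h : S.IsX v) (hp : S.IsX (S.par v)) : S.φ v (S.par v) = 2 := by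
  rw [φ_eq (not_ask hp.not_isZ), h.ψ_of_isX hp, if_pos rfl]

theorem IsX.φ_par_of_isC (h : S.IsX v) (hne : S.par v ≠ v) (hp : S.IsC (S.par v)) :
    S.φ v (S.par v) = 2 := by
  rw [φ_eq (not_ask hp.not_isZ), h.ψ_of_isC hp,
    if_neg fun h' => par_ne_of_par h.1 hne.symm rfl h'.2]

-- Each vertex contributes its bonus, minus 2, plus its edges. The edge to the parent restores the 2
-- for all but the root; in `hlower`, `k` bounds what the root still lacks.
open Classical in
theorem sum_tree_nonneg (ht : S.IsX t) (hpt : S.parX t = t) :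
    0 ≤ ∑ v with S.IsX v ∧ S.root v = t, (S.base v + ∑ w with S.G.Adj v w, S.ψ v w) := by
  have hroot := root_of_parX hpt
  set T : Finset V := {v | S.IsX v ∧ S.root v = t} with hT
  have hmem : ∀ v, v ∈ T ↔ S.IsX v ∧ S.root v = t := fun v => by simp [hT]
  have htT : t ∈ T := (hmem t).mpr ⟨ht, hroot⟩
  have hbonus : ∀ v ∈ T, 0 ≤ S.bonus v := fun v hv => ((hmem v).mp hv).1.bonus_nonneg
  have hgain : ∀ v ∈ T, 0 ≤ S.bonus v + S.rest v := fun v hv =>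
    add_nonneg (hbonus v hv) (S.rest_nonneg v)
  have hfull : ∀ v ∈ T, S.par v ≠ v → S.IsX (S.par v) ∨ S.IsC (S.par v) →
      S.bonus v + S.rest v ≤ S.base v + ∑ w with S.G.Adj v w, S.ψ v w := by
    intro v hv hne hp
    have hX := ((hmem v).mp hv).1
    obtain ⟨j, -, -, -, hpr⟩ := par_isPred hX.1 hne
    have h1 := rest_add_le_sum_φ hpr.2.2.1
    have h2 : S.φ v (S.par v) = 2 := by
      rcases hp with hp | hp
      · exact hX.φ_par_of_isX hp
      · exact hX.φ_par_of_isC hne hp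
    rw [hX.base_add_sum_eq]
    linarith
  have hnonroot : ∀ v ∈ T, v ≠ t →
      S.bonus v + S.rest v ≤ S.base v + ∑ w with S.G.Adj v w, S.ψ v w := by
    intro v hv hvt
    have hne : S.root v ≠ v := by
      rw [((hmem v).mp hv).2]
      exact hvt.symm
    exact hfull v hv (par_of_root_ne hne).2 (Or.inl (par_of_root_ne hne).1)
  have hlower : ∀ k : ℤ, S.bonus t + S.rest t - k ≤
        S.base t + ∑ w with S.G.Adj t w, S.ψ t w → k ≤ ∑ v ∈ T, (S.bonus v + S.rest v) →
      0 ≤ ∑ v ∈ T, (S.base v + ∑ w with S.G.Adj v w, S.ψ v w) := by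
    intro k h1 h2
    rw [← Finset.add_sum_erase T _ htT] at h2 ⊢
    have h3 : ∑ v ∈ T.erase t, (S.bonus v + S.rest v) ≤
        ∑ v ∈ T.erase t, (S.base v + ∑ w with S.G.Adj v w, S.ψ v w) :=
      Finset.sum_le_sum fun v hv =>
        hnonroot v (Finset.mem_of_mem_erase hv) (Finset.ne_of_mem_erase hv)
    linarith
  have hone : (S.par t = t ∨ S.IsE (S.par t)) → 1 ≤ ∑ v ∈ T, S.rest v := fun hlack => by
    obtain ⟨v, w, hv, hvt, hadj, hne, hφ⟩ := exists_extra_edge ht hroot hlack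
    exact (hφ.trans (φ_le_rest hadj hne)).trans
      (Finset.single_le_sum (f := S.rest) (fun v _ => S.rest_nonneg v) ((hmem v).mpr ⟨hv, hvt⟩))
  by_cases hp : S.par t = t
  · refine hlower 2 ?_ ?_
    · have := S.rest_le_sum_φ t
      rw [ht.base_add_sum_eq]
      linarith
    · have hedge : (∃ w, S.G.Adj t w ∧ 2 ≤ S.φ t w) → 2 ≤ ∑ v ∈ T, (S.bonus v + S.rest v) := by
        rintro ⟨w, hadj, hφ⟩
        refine le_trans ?_ (Finset.single_le_sum (f := fun v => S.bonus v + S.rest v) hgain htT)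
        have h1 := φ_le_rest hadj (by rw [hp]; exact hadj.ne')
        have h2 := hbonus t htT
        show (2 : ℤ) ≤ S.bonus t + S.rest t
        linarith
      by_cases hs : S.s t = 1
      · exact hedge (exists_edge_of_single ht hp hs)
      · have h1 := ht.one_le_s
        rcases exists_gain_of_home ht hp (by omega) with h | h | ⟨w, hw, hwt, hb⟩
        · exact hedge h
        · refine le_trans ?_ (Finset.single_le_sum (f := fun v => S.bonus v + S.rest v) hgain htT)
          have h2 := S.rest_nonneg t
          show (2 : ℤ) ≤ S.bonus t + S.rest t
          linarith
        · have hwT : w ∈ T := by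
            refine (hmem w).mpr ⟨hw, ?_⟩
            rw [← hw.root_par (by rw [hwt]; exact ht), hwt, hroot]
          have h2 := hb.trans (Finset.single_le_sum (f := S.bonus) hbonus hwT)
          have h3 := hone (Or.inl hp)
          rw [Finset.sum_add_distrib]
          linarith
  · obtain ⟨j, -, -, -, hpr⟩ := par_isPred ht.1 hp
    have hc := hpr.one_le_c
    have hnX : ¬ S.IsX (S.par t) := (par_eq_or_of_parX hpt).resolve_left hp
    rcases S.cases_c (S.par t) with h | h | h | h | h
    · refine hlower 0 ?_ (Finset.sum_nonneg hgain)
      have := hfull t htT hp (Or.inr h)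
      linarith
    · exact absurd h hnX
    · refine hlower 1 ?_ ?_
      · have h1 := rest_add_le_sum_φ hpr.2.2.1
        rw [ht.φ_of_isE h] at h1
        rw [ht.base_add_sum_eq]
        linarith
      · have h1 := hone (Or.inr h)
        have h2 := Finset.sum_nonneg hbonus
        rw [Finset.sum_add_distrib]
        linarith
    · have := h.1
      omega
    · have := h.1
      omega

open Classical in
theorem sum_isX_nonneg (S : UnitSystem V ι) :
    0 ≤ ∑ v with S.IsX v, (S.base v + ∑ w with S.G.Adj v w, S.ψ v w) := by
  rw [← Finset.sum_fiberwise_of_maps_to (g := S.root) (t := ({v | S.IsX v} : Finset V))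
    (fun v hv => by
      simp only [Finset.mem_filter, Finset.mem_univ, true_and] at hv ⊢
      exact hv.root)]
  refine Finset.sum_nonneg fun t ht => ?_
  simp only [Finset.mem_filter, Finset.mem_univ, true_and] at ht
  rw [Finset.filter_filter]
  by_cases hp : S.parX t = t
  · exact sum_tree_nonneg ht hp
  · rw [Finset.filter_false_of_mem fun v _ hv => hp (by rw [← hv.2]; exact hv.1.parX_root),
      Finset.sum_empty]

/-! ### Summation over all vertices -/

/-- The neighbor that sends the pebble has reach at least 2, but each unit brings it at most one, or
it would reach `v`. This excludes `IsE`, where the reach would be 1. -/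
theorem IsL.exists_adj (h : S.IsL v) : ∃ w, S.G.Adj v w ∧ S.IsH w := by
  obtain ⟨f, Q, hf⟩ := exists_isMinFlow (G := S.G) (P := S.P) (k := 1) (v := v) (S.one_le_r v)
  have hP := S.P_le_s v
  rw [s_eq_zero h.1] at hP
  obtain ⟨w, hw⟩ := hf.exists_into (by omega)
  have hr : 2 ≤ S.r w := (hf.source hw).1
  have hadj := (hf.adj hw).symm
  refine ⟨w, hadj, ?_⟩
  rcases S.cases_c w with hc | hc | hc | hc | hc
  · exact Or.inl hc
  · exact Or.inr (Or.inl hc)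
  · exfalso
    have h1 : S.s w = S.c w := s_eq_c fun i => by
      have := ri_div_two_le (i := i) hadj.symm
      rw [ri_eq_zero h.1 i] at this
      omega
    have := hc.1
    have := hc.2
    omega
  · exact Or.inr (Or.inr hc)
  · have := hc.2
    omega

/-- The contribution of `v` to the final inequality. -/
noncomputable def val (S : UnitSystem V ι) (v : V) : ℤ :=
  S.d * ((S.r v : ℤ) - S.s v + S.c v - 1) + S.c v - 1

open Classical in
theorem sum_isH_nonneg (S : UnitSystem V ι) :
    0 ≤ ∑ v with S.IsH v, (S.base v + ∑ w with S.G.Adj v w, S.ψ v w) := by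
  have hX := S.sum_isX_nonneg
  have hsub : ({v | S.IsX v} : Finset V) ⊆ ({v | S.IsH v} : Finset V) := fun v hv => by
    simp only [Finset.mem_filter, Finset.mem_univ, true_and] at hv ⊢
    exact Or.inr (Or.inl hv)
  refine hX.trans (Finset.sum_le_sum_of_subset_of_nonneg hsub fun v hv hv' => ?_)
  simp only [Finset.mem_filter, Finset.mem_univ, true_and] at hv hv'
  rcases hv with hv | hv | hv
  · exact hv.base_add_sum_nonneg
  · exact absurd hv hv'
  · exact hv.base_add_sum_nonneg

open Classical in
/-- The charge that `v` has to spare on the edge `vw`, if `w` is in `IsL` for one unit less. -/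
noncomputable def spare (S : UnitSystem V ι) (v w : V) : ℤ :=
  if S.IsH v ∧ S.G.Adj v w then 1 - S.ψ v w - (if S.IsL w then 1 else 0) else 0

theorem IsH.not_isL (h : S.IsH v) : ¬ S.IsL v := fun hl => by
  have h1 := hl.1
  have h2 := hl.2
  rcases h with h | h | h
  · unfold IsC at h
    omega
  · have := h.1
    omega
  · have := h.2
    omega

theorem spare_add_nonneg (S : UnitSystem V ι) (v w : V) : 0 ≤ S.spare v w + S.spare w v := by
  have key : ∀ v w, ¬ S.IsH w → 0 ≤ S.spare v w := by
    intro v w hw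
    unfold spare
    split_ifs with h1 h2
    · have := h2.ψ_le v
      linarith
    · have hE : S.IsE w := by
        rcases S.cases_c w with h | h | h | h | h
        · exact absurd (Or.inl h) hw
        · exact absurd (Or.inr (Or.inl h)) hw
        · exact h
        · exact absurd (Or.inr (Or.inr h)) hw
        · exact absurd h h2
      have := hE.ψ_le h1.2
      linarith
    · exact le_rfl
  have key' : ∀ v w, ¬ S.IsH w → S.spare w v = 0 := fun v w hw => by
    unfold spare
    rw [if_neg fun h => hw h.1]
  by_cases hv : S.IsH v
  · by_cases hw : S.IsH w
    · by_cases hadj : S.G.Adj v w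
      · have := ψ_add_ψ_le hadj.ne hv hw
        unfold spare
        rw [if_pos (show S.IsH v ∧ S.G.Adj v w from ⟨hv, hadj⟩),
          if_pos (show S.IsH w ∧ S.G.Adj w v from ⟨hw, hadj.symm⟩), if_neg hw.not_isL,
          if_neg hv.not_isL]
        linarith
      · unfold spare
        rw [if_neg fun h => hadj h.2, if_neg fun h => hadj h.2.symm]
        norm_num
    · rw [key' v w hw, add_zero]
      exact key v w hw
  · rw [key' w v hv, zero_add]
    exact key w v hv

theorem sum_spare_nonneg (S : UnitSystem V ι) : 0 ≤ ∑ v, ∑ w, S.spare v w := by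
  have h1 : ∑ v, ∑ w, S.spare v w = ∑ v, ∑ w, S.spare w v := Finset.sum_comm
  have h2 : 0 ≤ ∑ v, ∑ w, (S.spare v w + S.spare w v) :=
    Finset.sum_nonneg fun v _ => Finset.sum_nonneg fun w _ => S.spare_add_nonneg v w
  simp only [Finset.sum_add_distrib] at h2
  linarith

open Classical in
theorem card_isL_le (S : UnitSystem V ι) : (∑ v, if S.IsL v then (1 : ℤ) else 0) ≤
    ∑ v, ∑ w, if S.IsH v ∧ S.G.Adj v w then (if S.IsL w then 1 else 0) else 0 := by
  rw [Finset.sum_comm]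
  refine Finset.sum_le_sum fun w _ => ?_
  split_ifs with hw
  · obtain ⟨v, hadj, hv⟩ := hw.exists_adj
    refine le_trans (le_of_eq ?_) (Finset.single_le_sum
      (f := fun v => if S.IsH v ∧ S.G.Adj v w then (1 : ℤ) else 0) (fun v _ => ?_)
      (Finset.mem_univ v))
    · rw [if_pos ⟨hv, hadj.symm⟩]
    · split_ifs <;> norm_num
  · simp

open Classical in
theorem sum_spare_eq (S : UnitSystem V ι) (v : V) : (∑ w, S.spare v w) +
    (∑ w, if S.IsH v ∧ S.G.Adj v w then (if S.IsL w then 1 else 0) else 0) =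
    if S.IsH v then ∑ w with S.G.Adj v w, (1 - S.ψ v w) else 0 := by
  rw [← Finset.sum_add_distrib, Finset.sum_filter]
  by_cases hv : S.IsH v
  · rw [if_pos hv]
    refine Finset.sum_congr rfl fun w _ => ?_
    unfold spare
    by_cases hadj : S.G.Adj v w
    · have h : S.IsH v ∧ S.G.Adj v w := ⟨hv, hadj⟩
      rw [if_pos h, if_pos h, if_pos hadj]
      ring
    · rw [if_neg fun h => hadj h.2, if_neg fun h => hadj h.2, if_neg hadj]
      norm_num
  · rw [if_neg hv]
    refine Finset.sum_eq_zero fun w _ => ?_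
    unfold spare
    rw [if_neg fun h => hv h.1, if_neg fun h => hv h.1]
    norm_num

open Classical in
theorem le_val (S : UnitSystem V ι) (v : V) :
    (if S.IsH v then S.base v + ∑ w with S.G.Adj v w, S.ψ v w else 0) +
      (if S.IsH v then ∑ w with S.G.Adj v w, (1 - S.ψ v w) else 0) -
      (if S.IsL v then 1 else 0) ≤ S.val v := by
  by_cases hv : S.IsH v
  · rw [if_pos hv, if_pos hv, if_neg hv.not_isL, Finset.sum_sub_distrib, Finset.sum_const,
      nsmul_one]
    have h1 : ((#{w | S.G.Adj v w} : ℕ) : ℤ) ≤ S.d + 2 := by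
      refine le_trans (Nat.cast_le.mpr (S.card_le v)) (by push_cast; exact le_rfl)
    have h2 : S.val v = S.base v + (S.d + 2) := by
      unfold val base
      ring
    linarith
  · rw [if_neg hv, if_neg hv]
    rcases S.cases_c v with h | h | h | h | h
    · exact absurd (Or.inl h) hv
    · exact absurd (Or.inr (Or.inl h)) hv
    · have h1 : ¬ S.IsL v := fun h' => by
        have := h.1
        have := h'.1
        omega
      rw [if_neg h1]
      unfold val
      rw [h.1, h.2]
      push_cast
      linarith
    · exact absurd (Or.inr (Or.inr h)) hv
    · rw [if_pos h]
      unfold val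
      rw [h.1, h.2, s_eq_zero h.1]
      push_cast
      linarith

theorem sum_val_nonneg (S : UnitSystem V ι) : 0 ≤ ∑ v, S.val v := by
  classical
  refine le_trans ?_ (Finset.sum_le_sum fun v _ => S.le_val v)
  have h1 := S.sum_isH_nonneg
  rw [Finset.sum_filter] at h1
  have h2 := S.sum_spare_nonneg
  have h3 := S.card_isL_le
  have h4 := Finset.sum_congr (rfl : (Finset.univ : Finset V) = Finset.univ)
    fun v _ => S.sum_spare_eq v
  rw [Finset.sum_add_distrib] at h4
  rw [Finset.sum_sub_distrib, Finset.sum_add_distrib]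
  linarith

end UnitSystem

/-! ### From total excess to charges -/

section

variable {V : Type*} [Fintype V]

theorem exc_eq (G : SimpleGraph V) (P : Distribution V) (v : V) :
    exc G P v = reach G P v - 1 := by
  unfold exc
  split_ifs with h
  · rfl
  · rw [reachable_iff] at h
    omega

theorem TE_zero (G : SimpleGraph V) : TE G 0 = 0 := by
  refine Finset.sum_eq_zero fun v _ => ?_
  rw [exc_eq]
  -- Since 0 + 0 = 0, superadditivity gives `2 * reach ≤ reach`.
  have h := sum_reach_le G (Finset.univ : Finset (Fin 2)) (fun _ => (0 : Distribution V)) v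
  simp only [Finset.sum_const_zero, Finset.sum_const, Finset.card_univ, Fintype.card_fin,
    smul_eq_mul] at h
  omega

theorem sum_CE (G : SimpleGraph V) (t : ℕ) (U : Fin t → Distribution V) :
    ∑ i, CE G (∑ k ∈ Finset.Iio i, U k) (U i) = (TE G (∑ i, U i) : ℤ) - ∑ i, (TE G (U i) : ℤ) := by
  induction t with
  | zero => simp [TE_zero]
  | succ t ih =>
    have h1 : ∀ i : Fin t, ∑ k ∈ Finset.Iio i.castSucc, U k =
        ∑ k ∈ Finset.Iio i, U k.castSucc := fun i => by
      rw [← Fin.map_castSuccEmb_Iio, Finset.sum_map]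
      rfl
    have h2 : ∑ k ∈ Finset.Iio (Fin.last t), U k = ∑ k : Fin t, U k.castSucc := by
      have : Finset.Iio (Fin.last t) = Finset.univ.map Fin.castSuccEmb := by
        ext k
        simp only [Finset.mem_Iio, Finset.mem_map, Finset.mem_univ, true_and,
          Fin.coe_castSuccEmb]
        exact ⟨fun h => ⟨k.castPred h.ne, Fin.castSucc_castPred k h.ne⟩,
          fun ⟨a, ha⟩ => ha ▸ Fin.castSucc_lt_last a⟩
      rw [this, Finset.sum_map]
      rfl
    rw [Fin.sum_univ_castSucc, Fin.sum_univ_castSucc (f := U), Fin.sum_univ_castSucc, h2]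
    simp only [h1]
    rw [ih fun i => U i.castSucc, CE]
    ring

end

namespace UnitSystem

variable {V ι : Type*} [Fintype V] [Fintype ι]

theorem sum_cov (S : UnitSystem V ι) : ∑ i, cov S.G (S.U i) = ∑ v, S.c v := by
  classical
  have h1 : ∀ i, cov S.G (S.U i) = ∑ v, if 1 ≤ S.ri i v then 1 else 0 := fun i => by
    rw [← Finset.card_filter, cov, ← Set.ncard_coe_finset]
    congr 1
    ext v
    simp only [Set.mem_ofPred_eq, Finset.coe_filter, Finset.mem_univ, true_and]
    exact reachable_iff
  have h2 : ∀ v, S.c v = ∑ i, if 1 ≤ S.ri i v then 1 else 0 := fun v => by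
    rw [← Finset.card_filter, c]
  simp only [h1, h2]
  exact Finset.sum_comm

theorem TE_sub_sum_TE (S : UnitSystem V ι) : (TE S.G S.P : ℤ) - ∑ i, (TE S.G (S.U i) : ℤ) =
    ∑ v, ((S.r v : ℤ) - S.s v + S.c v - 1) := by
  classical
  have h1 : ∀ v, ∑ i, (exc S.G (S.U i) v : ℤ) = (S.s v : ℤ) - S.c v := fun v => by
    have h2 : (S.c v : ℤ) = ∑ i, if 1 ≤ S.ri i v then (1 : ℤ) else 0 := by
      rw [c, Finset.card_filter]
      push_cast
      congr
    rw [h2, s, Nat.cast_sum, ← Finset.sum_sub_distrib]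
    refine Finset.sum_congr rfl fun i _ => ?_
    rw [exc_eq]
    change ((S.ri i v - 1 : ℕ) : ℤ) = _
    split_ifs <;> omega
  have h3 : ∀ v, (exc S.G S.P v : ℤ) = (S.r v : ℤ) - 1 := fun v => by
    rw [exc_eq]
    change ((S.r v - 1 : ℕ) : ℤ) = _
    have := S.one_le_r v
    omega
  simp only [TE, Nat.cast_sum]
  rw [Finset.sum_comm, ← Finset.sum_sub_distrib]
  refine Finset.sum_congr rfl fun v _ => ?_
  rw [h1, h3]
  ring

theorem card_sub_sum_cov_le (S : UnitSystem V ι) :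
    (Fintype.card V : ℤ) - ∑ i, (cov S.G (S.U i) : ℤ) ≤
      S.d * ((TE S.G S.P : ℤ) - ∑ i, (TE S.G (S.U i) : ℤ)) := by
  have h1 := S.sum_val_nonneg
  have h2 : (∑ i, (cov S.G (S.U i) : ℤ)) = ∑ v, (S.c v : ℤ) := by exact_mod_cast S.sum_cov
  have h3 : ∑ v, S.val v = S.d * ∑ v, ((S.r v : ℤ) - S.s v + S.c v - 1) +
      (∑ v, (S.c v : ℤ) - Fintype.card V) := by
    rw [Finset.mul_sum, Fintype.card, Finset.card_eq_sum_ones, Nat.cast_sum,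
      ← Finset.sum_sub_distrib, ← Finset.sum_add_distrib]
    refine Finset.sum_congr rfl fun v _ => ?_
    unfold val
    push_cast
    ring
  rw [TE_sub_sum_TE, h2]
  linarith

theorem sum_cov_sub_card_le (S : UnitSystem V ι) :
    (∑ i, (cov S.G (S.U i) : ℤ)) - Fintype.card V ≤
      (TE S.G S.P : ℤ) - ∑ i, (TE S.G (S.U i) : ℤ) := by
  have h2 : (∑ i, (cov S.G (S.U i) : ℤ)) = ∑ v, (S.c v : ℤ) := by exact_mod_cast S.sum_cov
  rw [TE_sub_sum_TE, h2, Fintype.card, Finset.card_eq_sum_ones, Nat.cast_sum,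
    ← Finset.sum_sub_distrib]
  refine Finset.sum_le_sum fun v _ => ?_
  have := S.s_le_r v
  push_cast
  omega

theorem TE_sub_sum_TE_nonneg (S : UnitSystem V ι) :
    0 ≤ (TE S.G S.P : ℤ) - ∑ i, (TE S.G (S.U i) : ℤ) := by
  rw [TE_sub_sum_TE]
  refine Finset.sum_nonneg fun v _ => ?_
  have h1 := S.s_le_r v
  have h2 := S.one_le_r v
  by_cases h0 : S.c v = 0
  · have := s_eq_zero h0
    omega
  · omega

end UnitSystem

/-! ### The theorem -/

theorem exists_unitSystem {V : Type*} [Fintype V] (G : SimpleGraph V) [DecidableRel G.Adj]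
    {P : Distribution V} (hP : Solvable G P) {t : ℕ} {U : Fin t → Distribution V}
    (hU : IsUnitDecomposition P U) {d : ℕ} (hd : 1 ≤ d) (hG : G.maxDegree ≤ d + 2) :
    ∃ S : UnitSystem V (Fin t), S.G = G ∧ S.U = U ∧ S.d = d := by
  choose x hx hx' using hU.unit
  refine ⟨⟨G, U, x, fun i w hw => ?_, fun i => hx i, fun i j hij => ?_, fun v => ?_, d, hd,
    fun v => ?_⟩, rfl, rfl, rfl⟩
  · by_contra h0
    exact hw (hx' i w (Nat.pos_of_ne_zero h0))
  · by_contra hne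
    exact hU.disjoint i j hne (x i) ⟨hx i, hij ▸ hx j⟩
  · rw [hU.sum_eq]
    exact reachable_iff.mp (hP v)
  · refine le_trans (le_of_eq ?_) ((G.degree_le_maxDegree v).trans hG)
    rw [← SimpleGraph.card_neighborFinset_eq_degree, SimpleGraph.neighborFinset_eq_filter]
    congr

end Pebbling

theorem mainTheorem4 {V : Type*} [Fintype V] (G : SimpleGraph V) [DecidableRel G.Adj]
    (hΔ : G.maxDegree ≠ 2)
    (P : Pebbling.Distribution V) (hP : Pebbling.Solvable G P)
    (t : ℕ) (U : Fin t → Pebbling.Distribution V)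
    (hU : Pebbling.IsUnitDecomposition P U)
    (hmono : ∀ i j : Fin t, i ≤ j → Pebbling.size (U i) ≤ Pebbling.size (U j)) :
    ((∑ i : Fin t, Pebbling.CE G (∑ k ∈ Finset.Iio i, U k) (U i) : ℤ) : ℝ) ≥
      ((Fintype.card V : ℝ) - ∑ i : Fin t, (Pebbling.cov G (U i) : ℝ)) /
        ((G.maxDegree : ℝ) - 2) := by
  rw [Pebbling.sum_CE]
  rcases Nat.lt_or_ge G.maxDegree 2 with hlt | hge
  · obtain ⟨S, rfl, rfl, -⟩ := Pebbling.exists_unitSystem G hP hU le_rfl (by omega)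
    have h1 := S.sum_cov_sub_card_le
    have h2 := S.TE_sub_sum_TE_nonneg
    unfold Pebbling.UnitSystem.P at h1 h2
    generalize (Pebbling.TE S.G (∑ i, S.U i) : ℤ) - ∑ i, (Pebbling.TE S.G (S.U i) : ℤ) = a
      at h1 h2 ⊢
    have h1' : ∑ i, (Pebbling.cov S.G (S.U i) : ℝ) - Fintype.card V ≤ a := by exact_mod_cast h1
    have h2' : (0 : ℝ) ≤ a := by exact_mod_cast h2
    have h3 : (S.G.maxDegree : ℝ) ≤ 1 := by exact_mod_cast Nat.lt_succ_iff.mp hlt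
    -- As `Δ - 2 ≤ -1` and `a ≥ 0`, the product `a * (Δ - 2)` is at most `-a`.
    rw [ge_iff_le, div_le_iff_of_neg (by linarith)]
    nlinarith
  · obtain ⟨S, rfl, rfl, hd⟩ := Pebbling.exists_unitSystem G hP hU (d := G.maxDegree - 2)
      (by omega) (by omega)
    have h1 := S.card_sub_sum_cov_le
    unfold Pebbling.UnitSystem.P at h1
    generalize (Pebbling.TE S.G (∑ i, S.U i) : ℤ) - ∑ i, (Pebbling.TE S.G (S.U i) : ℤ) = a at h1 ⊢
    have h1' : (Fintype.card V : ℝ) - ∑ i, (Pebbling.cov S.G (S.U i) : ℝ) ≤ S.d * a := by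
      exact_mod_cast h1
    have h3 : (3 : ℝ) ≤ S.G.maxDegree := by exact_mod_cast (by omega : 3 ≤ S.G.maxDegree)
    rw [hd, Nat.cast_sub hge] at h1'
    push_cast at h1'
    rw [ge_iff_le, div_le_iff₀ (by linarith)]
    linarith
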